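/- Conventions. A $*$-probability space is a pair $(\mathcal A,\varphi)$, where $\mathcal A$ is a unital complex $*$-algebra and $\varphi:\mathcal A\to\mathbb C$ is a linear functional with $\varphi(1)=1$; its elements are called variables. Variables $a_n\in(\mathcal A_n,\varphi_n)$ converge in $*$-distribution to $a\in(\mathcal A,\varphi)$ if $\varphi_n(Q(a_n,a_n^*))\to\varphi(Q(a,a^*))$ as $n\to\infty$ for every monomial $Q$ in two non-commuting indeterminates. For a probability space $(\Omega,\mathcal F,P)$, let $\mathcal M_n$ be the $*$-algebra of $n\times n$ complex random matrices on $\Omega$ all of whose entries have finite moments of all orders, with the state $\varphi_n=n^{-1}\mathbb E\,\mathrm{Tr}$. Let $(l_j)_{j\ge 0}$ be a sequence of real random variables on $(\Omega,\mathcal F,P)$. For $n\ge 1$ let $L_n=\mathrm{LScirc}(l_0,\dots,l_{n-1})$ be the $n\times n$ left skew-circulant matrix: for $0\le i,j\le n-1$ its $(i,j)$ entry is $l_{i+j}$ if $i+j\le n-1$, and $-l_{i+j-n}$ if $i+j\ge n$. This is a real symmetric matrix. Theorem 3.3. (i) Suppose that the $l_j$ are independent with $\mathbb E\,l_j=0$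 and $\mathbb E\,l_j^2=1$, and that $\sup_{j}\mathbb E|l_j|^p<\infty$ for every $p\in\mathbb N$. Then $n^{-1/2}L_n$, as an element of $(\mathcal M_n,\varphi_n)$, converges in $*$-distribution to a self-adjoint variable $a$ in some $*$-probability space $(\mathcal A,\varphi)$, with $\varphi(a^{2m-1})=0$ and $\varphi(a^{2m})=m!$ for every $m\ge 1$. (ii) Suppose that the $l_j$ are independent and identically distributed with mean $0$ and variance $1$. Then, almost surely, the empirical spectral distribution $n^{-1}\sum_{j=1}^n\delta_{\lambda_j}$ of $n^{-1/2}L_n$ (where $\lambda_1,\dots,\lambda_n$ are its eigenvalues, counted with multiplicity) converges weakly, as $n\to\infty$, to the symmetrized Rayleigh distribution, the probability measure on $\mathbb R$ with density $|x|e^{-x^2}$. -/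

import Mathlib

open MeasureTheory ProbabilityTheory Filter Topology

noncomputable section

/-! ### Non-commutative probability spaces and convergence in `*`-distribution -/

/-- A state on a unital complex `*`-algebra `A`: a complex linear functional `φ` with `φ 1 = 1`.
The pair `(A, φ)` is a (non-commutative) `*`-probability space. -/
structure NCState (A : Type*) [Ring A] [StarRing A] [Algebra ℂ A] where
  /-- the underlying linear functional -/
  toLin : A →ₗ[ℂ] ℂ
  map_one : toLin 1 = 1

/-- A monomial in two non-commuting indeterminates `x`, `x*`, written as a word: the letter `false`
stands for `x`, the letter `true` for `x*`. -/
abbrev StarMonomial : Type := List Bool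

/-- The value of a `*`-monomial at a variable `a`. -/
def StarMonomial.eval {A : Type*} [Ring A] [StarRing A] (Q : StarMonomial) (a : A) : A :=
  (Q.map (fun b => if b then star a else a)).prod

/-- Convergence in `*`-distribution of `a n ∈ (A n, φ n)` to `b ∈ (B, ψ)`: all `*`-moments converge. -/
def ConvergesInStarDistribution {A : ℕ → Type*} [∀ n, Ring (A n)] [∀ n, StarRing (A n)]
    [∀ n, Algebra ℂ (A n)] (φ : ∀ n, NCState (A n)) (a : ∀ n, A n)
    {B : Type*} [Ring B] [StarRing B] [Algebra ℂ B] (ψ : NCState B) (b : B) : Prop :=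
  ∀ Q : StarMonomial,
    Tendsto (fun n => (φ n).toLin (Q.eval (a n))) atTop (𝓝 (ψ.toLin (Q.eval b)))

/-! ### The `*`-probability space of random matrices -/

section RandomMatrix

variable {Ω : Type*} [MeasurableSpace Ω]

theorem memLp_nat_mul {P : Measure Ω} {f g : Ω → ℂ} (hf : ∀ p : ℕ, MemLp f p P)
    (hg : ∀ p : ℕ, MemLp g p P) (p : ℕ) : MemLp (fun ω => f ω * g ω) p P := by
  have h2 : (((2 * p : ℕ) : ENNReal))⁻¹ + (((2 * p : ℕ) : ENNReal))⁻¹ = ((p : ℕ) : ENNReal)⁻¹ := by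
    push_cast
    rw [ENNReal.mul_inv (by simp) (by simp), ← add_mul, ENNReal.inv_two_add_inv_two, one_mul]
  have : ENNReal.HolderTriple ((2 * p : ℕ) : ENNReal) ((2 * p : ℕ) : ENNReal) (p : ENNReal) := ⟨h2⟩
  exact (hg (2 * p)).mul' (hf (2 * p))

/-- The `*`-algebra of `n × n` complex random matrices all of whose entries have finite moments of
all orders; the involution is the (pointwise) conjugate transpose. -/
def randomMatrixAlgebra (P : Measure Ω) [IsProbabilityMeasure P] (n : ℕ) :
    StarSubalgebra ℂ (Ω → Matrix (Fin n) (Fin n) ℂ) where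
  carrier := {M | ∀ i j, ∀ p : ℕ, MemLp (fun ω => M ω i j) p P}
  mul_mem' := by
    intro M N hM hN i j p
    have h : (fun ω => (M * N) ω i j) = fun ω => ∑ k, M ω i k * N ω k j := by
      funext ω
      simp [Matrix.mul_apply]
    rw [h]
    exact memLp_finsetSum _ fun k _ => memLp_nat_mul (hM i k) (hN k j) p
  add_mem' := by
    intro M N hM hN i j p
    exact (hM i j p).add (hN i j p)
  algebraMap_mem' := by
    intro c i j p
    exact memLp_const (algebraMap ℂ (Matrix (Fin n) (Fin n) ℂ) c i j)
  star_mem' := by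
    intro M hM i j p
    exact (hM j i p).star

theorem randomMatrixAlgebra.integrable_trace {P : Measure Ω} [IsProbabilityMeasure P] {n : ℕ}
    (M : randomMatrixAlgebra P n) : Integrable (fun ω => (M.1 ω).trace) P := by
  have h : (fun ω => (M.1 ω).trace) = fun ω => ∑ i, M.1 ω i i := rfl
  rw [h]
  refine integrable_finsetSum _ fun i _ => ?_
  have := M.2 i i 1
  exact memLp_one_iff_integrable.1 (by exact_mod_cast this)

/-- The state `φₙ = n⁻¹ 𝔼 Tr` on the algebra of `n × n` random matrices. -/
def randomMatrixState (P : Measure Ω) [IsProbabilityMeasure P] (n : ℕ) [NeZero n] :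
    NCState (randomMatrixAlgebra P n) where
  toLin :=
    { toFun := fun M => (n : ℂ)⁻¹ * ∫ ω, (M.1 ω).trace ∂P
      map_add' := by
        intro M N
        rw [← mul_add, ← integral_add (randomMatrixAlgebra.integrable_trace M)
          (randomMatrixAlgebra.integrable_trace N)]
        simp [Matrix.trace_add]
      map_smul' := by
        intro c M
        have h : ∀ ω, ((c • M).1 ω).trace = c * (M.1 ω).trace := by
          intro ω
          simp [Matrix.trace_smul]
        simp only [h, integral_const_mul, RingHom.id_apply, smul_eq_mul]
        ring }
  map_one := by
    have hn : (n : ℂ) ≠ 0 := Nat.cast_ne_zero.2 (NeZero.ne n)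
    simp [hn]

end RandomMatrix

/-! ### Left skew-circulant matrices -/

/-- The `n × n` left skew-circulant matrix `LScirc(l₀, …, lₙ₋₁)`, rows and columns numbered from `0`:
the `(i, j)` entry is `l (i + j)` if `i + j ≤ n - 1` and `- l (i + j - n)` otherwise. -/
def leftSkewCirculant (n : ℕ) (l : ℕ → ℝ) : Matrix (Fin n) (Fin n) ℝ :=
  Matrix.of fun i j =>
    if (i : ℕ) + (j : ℕ) < n then l ((i : ℕ) + (j : ℕ)) else - l ((i : ℕ) + (j : ℕ) - n)

/-- The normalized matrix `n^{-1/2} Lₙ`. -/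
def normalizedLeftSkewCirculant (n : ℕ) (l : ℕ → ℝ) : Matrix (Fin n) (Fin n) ℝ :=
  (Real.sqrt n)⁻¹ • leftSkewCirculant n l

theorem normalizedLeftSkewCirculant_isHermitian (n : ℕ) (l : ℕ → ℝ) :
    (normalizedLeftSkewCirculant n l).IsHermitian := by
  ext i j
  simp [normalizedLeftSkewCirculant, leftSkewCirculant, add_comm]

/-! ### Assumptions on the input sequence -/

section Assumptions

variable {Ω : Type*} [MeasurableSpace Ω]

/-- Independent real random variables with mean zero, variance one, and, for each order, moments that
are finite and bounded uniformly along the sequence. -/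
structure IndepStandardBddMoments (l : ℕ → Ω → ℝ) (P : Measure Ω) : Prop where
  measurable : ∀ j, Measurable (l j)
  indep : iIndepFun l P
  memLp : ∀ j, ∀ p : ℕ, MemLp (l j) p P
  mean : ∀ j, ∫ ω, l j ω ∂P = 0
  variance : ∀ j, Var[l j; P] = 1
  bdd : ∀ p : ℕ, ∃ C : ℝ, ∀ j, ∫ ω, |l j ω| ^ p ∂P ≤ C

/-- Independent identically distributed real random variables with mean zero and variance one. -/
structure IIDStandard (l : ℕ → Ω → ℝ) (P : Measure Ω) : Prop where
  measurable : ∀ j, Measurable (l j)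
  indep : iIndepFun l P
  identDistrib : ∀ j, IdentDistrib (l j) (l 0) P P
  memLp : MemLp (l 0) 2 P
  mean : ∫ ω, l 0 ω ∂P = 0
  variance : Var[l 0; P] = 1

/-- The random matrix `n^{-1/2} Lₙ`, with input sequence `l`, as an element of the `*`-algebra of
random matrices with finite moments of all orders. -/
def leftSkewCirculantVariable {l : ℕ → Ω → ℝ} {P : Measure Ω} [IsProbabilityMeasure P]
    (hl : IndepStandardBddMoments l P) (n : ℕ) : randomMatrixAlgebra P n :=
  ⟨fun ω => (normalizedLeftSkewCirculant n (fun k => l k ω)).map Complex.ofReal, by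
    intro i j p
    have key : MemLp (fun ω => normalizedLeftSkewCirculant n (fun k => l k ω) i j) p P := by
      simp only [normalizedLeftSkewCirculant, leftSkewCirculant, Matrix.smul_apply, Matrix.of_apply]
      by_cases h : (i : ℕ) + (j : ℕ) < n
      · simp only [h, if_true]
        exact (hl.memLp ((i : ℕ) + (j : ℕ)) p).const_smul (Real.sqrt n)⁻¹
      · simp only [h, if_false]
        exact (hl.memLp ((i : ℕ) + (j : ℕ) - n) p).neg.const_smul (Real.sqrt n)⁻¹
    exact key.ofReal⟩

end Assumptions

/-! ### Empirical spectral distribution and the limit law -/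

/-- The empirical spectral distribution `n⁻¹ ∑ⱼ δ_{λⱼ}` of a real symmetric `n × n` matrix, `n ≥ 1`,
with eigenvalues `λⱼ` counted with multiplicity. -/
def empiricalSpectralDistribution {n : ℕ} [NeZero n] (A : Matrix (Fin n) (Fin n) ℝ)
    (hA : A.IsHermitian) : ProbabilityMeasure ℝ :=
  ⟨(n : ENNReal)⁻¹ • ∑ j, Measure.dirac (hA.eigenvalues j), ⟨by
    have hn : (n : ENNReal) ≠ 0 := Nat.cast_ne_zero.2 (NeZero.ne n)
    simp [ENNReal.inv_mul_cancel hn (ENNReal.natCast_ne_top n)]⟩⟩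

theorem lintegral_symmetrizedRayleigh :
    ∫⁻ x : ℝ, ENNReal.ofReal (|x| * Real.exp (-x ^ 2)) = 1 := by
  have hint : Integrable (fun x : ℝ => |x| * Real.exp (-x ^ 2)) := by
    have h := (integrable_mul_exp_neg_mul_sq (b := 1) one_pos).abs
    refine h.congr (Eventually.of_forall fun x => ?_)
    simp [abs_mul]
  rw [← ofReal_integral_eq_lintegral_ofReal hint (Eventually.of_forall fun x => by positivity)]
  have h1 : ∫ x : ℝ, |x| * Real.exp (-x ^ 2) = ∫ x : ℝ, |x| * Real.exp (-|x| ^ 2) := by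
    simp
  have h2 : ∫ x in Set.Ioi (0 : ℝ), x * Real.exp (-x ^ 2) = 1 / 2 := by
    have h := integral_rpow_mul_exp_neg_rpow (p := 2) (q := 1) (by norm_num) (by norm_num)
    norm_num at h
    simpa using h
  rw [h1, integral_comp_abs (f := fun x => x * Real.exp (-x ^ 2)), h2]
  norm_num

/-- The (standard) symmetrized Rayleigh distribution, with density `|x| e^{-x²}` on `ℝ`. -/
def symmetrizedRayleigh : ProbabilityMeasure ℝ :=
  ⟨volume.withDensity (fun x : ℝ => ENNReal.ofReal (|x| * Real.exp (-x ^ 2))), ⟨by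
    rw [withDensity_apply _ MeasurableSet.univ, Measure.restrict_univ]
    exact lintegral_symmetrizedRayleigh⟩⟩

end

/-! Let ζ_k run over the n-th roots of -1, put v_k = (ζ_k^j)_j and Λ_k = ∑ l_j ζ_k^j. The sign
change of the matrix is exactly absorbed by ζ_k^n = -1, so L_n v_k = Λ_k conj(v_k), and conj(v_k) is
the vector of the conjugate root. As the l_j are real, L_n² multiplies v_k by |Λ_k|². Each conjugate
pair of roots thus yields the eigenvalues ±|Λ_k|, and the real root -1, present only for odd n,
yields Λ_k itself (`sum_comp_eigenvalues_leftSkewCirculant`). Up to that one eigenvalue, the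
spectral distribution is the law of a random sign times |Λ_k| with k uniform, so everything reduces
to the average over k of the laws of n^{-1/2} Λ_k. Their limit is the standard complex Gaussian,
whose modulus is Rayleigh.

For (i), a Lyapunov argument, uniform in the non-real roots, gives convergence of the averaged
characteristic functions (`tendsto_average_integral_exp_inner`). Moment bounds uniform in n and k
(`exists_bound_integral_norm_normalizedSkewFourier_pow`) upgrade weak convergence to convergence of
even moments. Odd traces see only the real root and vanish after division by n.

For (ii), the empirical characteristic function of the n^{-1/2} Λ_k must converge almost surely. For
bounded inputs, `efron_stein` applied twice bounds its fourth central moment by a multiple of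
n^{-2}, which is summable (`ae_tendsto_averageCos_sub_integral`), while its mean is handled as in
(i). General inputs are truncated and centred: by Parseval the error is controlled by the empirical
mean square of the discarded part, to which the strong law applies. Lévy's continuity theorem then
gives weak convergence. -/

/-! ### Roots of -1, Parseval's identity, and traces of powers of the left skew-circulant. -/

section SkewFourier

open Complex ComplexConjugate

/-- The `n`-th roots of `-1`, indexed so that `Fin.rev` is complex conjugation. -/
noncomputable def skewRoot (n : ℕ) (k : Fin n) : ℂ :=
  exp ((Real.pi * (2 * (k : ℕ) + 1) / n : ℝ) * I)

theorem norm_skewRoot (n : ℕ) (k : Fin n) : ‖skewRoot n k‖ = 1 :=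
  norm_exp_ofReal_mul_I _

theorem skewRoot_ne_zero (n : ℕ) (k : Fin n) : skewRoot n k ≠ 0 := exp_ne_zero _

theorem skewRoot_pow_self (n : ℕ) (k : Fin n) : skewRoot n k ^ n = -1 := by
  have hn : (n : ℂ) ≠ 0 := Nat.cast_ne_zero.2 (Fin.pos k).ne'
  rw [skewRoot, ← exp_nat_mul]
  have : (n : ℂ) * (((Real.pi * (2 * (k : ℕ) + 1) / n : ℝ) : ℂ) * I)
      = (k : ℕ) * (2 * Real.pi * I) + Real.pi * I := by
    push_cast
    field_simp
  rw [this, exp_add, exp_nat_mul_two_pi_mul_I, exp_pi_mul_I, one_mul]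

theorem conj_skewRoot (n : ℕ) (k : Fin n) : conj (skewRoot n k) = skewRoot n k.rev := by
  have hn : (n : ℂ) ≠ 0 := Nat.cast_ne_zero.2 (Fin.pos k).ne'
  have hk : ((k.rev : ℕ) : ℂ) = n - (k + 1) := by
    rw [Fin.val_rev, Nat.cast_sub (by omega)]
    push_cast
    ring
  rw [skewRoot, skewRoot, ← exp_conj, ← exp_periodic (conj _)]
  congr 1
  simp only [map_mul, conj_ofReal, conj_I]
  push_cast
  rw [hk]
  field_simp
  ring

theorem skewRoot_mul_conj (n : ℕ) (k : Fin n) : skewRoot n k * conj (skewRoot n k) = 1 := by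
  rw [mul_conj, normSq_eq_norm_sq, norm_skewRoot]
  simp

theorem skewRoot_injective (n : ℕ) : Function.Injective (skewRoot n) := by
  intro k k' h
  have hn : (n : ℂ) ≠ 0 := Nat.cast_ne_zero.2 (Fin.pos k).ne'
  rw [skewRoot, skewRoot, exp_eq_exp_iff_exists_int] at h
  obtain ⟨m, hm⟩ := h
  have h2 : ((k : ℕ) : ℂ) = (k' : ℕ) + m * n := by
    have hpi : (2 * Real.pi * I : ℂ) ≠ 0 := two_pi_I_ne_zero
    apply mul_left_cancel₀ hpi
    push_cast at hm
    field_simp at hm ⊢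
    linear_combination hm / 2
  have h3 : ((k : ℕ) : ℤ) = (k' : ℕ) + m * n := by exact_mod_cast h2
  have hk := k.2
  have hk' := k'.2
  have hm0 : m = 0 := by
    have h4 : m * n < 1 * n := by omega
    have h5 : -1 * n < m * n := by omega
    have hn' : (0 : ℤ) < n := by exact_mod_cast (Fin.pos k)
    have := lt_of_mul_lt_mul_right h4 hn'.le
    have := lt_of_mul_lt_mul_right h5 hn'.le
    omega
  rw [hm0] at h3
  ext
  omega

/-- A geometric sum whose ratio has n-th power (-1)(-1) = 1; the ratio is 1 only when the two roots
coincide. -/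
theorem sum_skewRoot_pow_mul_conj (n : ℕ) (k k' : Fin n) :
    ∑ j : Fin n, conj (skewRoot n k ^ (j : ℕ)) * skewRoot n k' ^ (j : ℕ)
      = if k = k' then (n : ℂ) else 0 := by
  have h : ∀ j : Fin n, conj (skewRoot n k ^ (j : ℕ)) * skewRoot n k' ^ (j : ℕ)
      = (conj (skewRoot n k) * skewRoot n k') ^ (j : ℕ) := fun j => by rw [map_pow, mul_pow]
  simp_rw [h]
  rw [Fin.sum_univ_eq_sum_range (fun j => (conj (skewRoot n k) * skewRoot n k') ^ j)]
  split_ifs with hk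
  · subst hk
    rw [mul_comm, skewRoot_mul_conj]
    simp
  · have h1 : conj (skewRoot n k) * skewRoot n k' ≠ 1 := by
      intro h1
      apply hk
      apply skewRoot_injective
      have := congrArg (skewRoot n k * ·) h1
      simp only [← mul_assoc, skewRoot_mul_conj, one_mul, mul_one] at this
      exact this.symm
    rw [geom_sum_eq h1, mul_pow, ← map_pow, skewRoot_pow_self, skewRoot_pow_self]
    simp

/-- The matrix whose columns are the vectors of powers of the roots of `-1`. -/
noncomputable def skewVandermonde (n : ℕ) : Matrix (Fin n) (Fin n) ℂ :=
  Matrix.of fun j k => skewRoot n k ^ (j : ℕ)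

theorem skewVandermonde_conjTranspose_mul (n : ℕ) :
    (skewVandermonde n).conjTranspose * skewVandermonde n = (n : ℂ) • 1 := by
  ext k k'
  simp only [skewVandermonde, Matrix.mul_apply, Matrix.conjTranspose_apply, Matrix.of_apply,
    Matrix.smul_apply, Matrix.one_apply, smul_eq_mul, mul_ite, mul_one, mul_zero]
  exact sum_skewRoot_pow_mul_conj n k k'

theorem skewVandermonde_mul_conjTranspose (n : ℕ) :
    skewVandermonde n * (skewVandermonde n).conjTranspose = (n : ℂ) • 1 := by
  rcases Nat.eq_zero_or_pos n with rfl | hpos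
  · ext i; exact i.elim0
  have hn : (n : ℂ) ≠ 0 := Nat.cast_ne_zero.2 hpos.ne'
  have h : ((n : ℂ)⁻¹ • (skewVandermonde n).conjTranspose) * skewVandermonde n = 1 := by
    rw [smul_mul_assoc, skewVandermonde_conjTranspose_mul, smul_smul, inv_mul_cancel₀ hn, one_smul]
  have h2 := mul_eq_one_comm.1 h
  rw [mul_smul_comm] at h2
  rw [← h2, smul_smul, mul_inv_cancel₀ hn, one_smul]

/-- Parseval for a scaled unitary matrix. It serves both the Vandermonde matrix (sums over roots)
and its transpose (sums over time). -/
theorem sum_norm_sq_mulVec_of_conjTranspose_mul {m : Type*} [Fintype m] [DecidableEq m]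
    (V : Matrix m m ℂ) (c : ℝ) (hV : V.conjTranspose * V = (c : ℂ) • 1) (s : m → ℂ) :
    ∑ i, ‖(V.mulVec s) i‖ ^ 2 = c * ∑ i, ‖s i‖ ^ 2 := by
  have key : star (V.mulVec s) ⬝ᵥ (V.mulVec s) = (c : ℂ) * (star s ⬝ᵥ s) := by
    rw [Matrix.star_mulVec, Matrix.dotProduct_mulVec, Matrix.vecMul_vecMul, hV]
    simp [Matrix.vecMul_smul]
  have e : ∀ u : m → ℂ, star u ⬝ᵥ u = ((∑ i, ‖u i‖ ^ 2 : ℝ) : ℂ) := by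
    intro u
    simp only [dotProduct, Pi.star_apply, ofReal_sum, ofReal_pow]
    refine Finset.sum_congr rfl fun i _ => ?_
    rw [Complex.star_def, conj_mul']
  rw [e, e] at key
  exact_mod_cast key

theorem sum_norm_sq_sum_mul_skewRoot_pow (n : ℕ) (s : Fin n → ℂ) :
    ∑ j : Fin n, ‖∑ k, s k * skewRoot n k ^ (j : ℕ)‖ ^ 2 = n * ∑ k, ‖s k‖ ^ 2 := by
  rw [← sum_norm_sq_mulVec_of_conjTranspose_mul (skewVandermonde n) n
    (by simpa using skewVandermonde_conjTranspose_mul n) s]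
  simp [Matrix.mulVec, dotProduct, skewVandermonde, mul_comm]

/-- The discrete Fourier transform of `y` at the `n`-th roots of `-1`. -/
noncomputable def skewFourier (n : ℕ) (y : ℕ → ℝ) (k : Fin n) : ℂ :=
  ∑ j : Fin n, (y j : ℂ) * skewRoot n k ^ (j : ℕ)

theorem sum_norm_sq_skewFourier (n : ℕ) (y : ℕ → ℝ) :
    ∑ k, ‖skewFourier n y k‖ ^ 2 = n * ∑ j : Fin n, y j ^ 2 := by
  have h := sum_norm_sq_mulVec_of_conjTranspose_mul (skewVandermonde n).transpose n
    (by
      have := congrArg Matrix.transpose (skewVandermonde_mul_conjTranspose n)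
      rw [Matrix.transpose_mul] at this
      simpa [Matrix.conjTranspose, Matrix.transpose_map] using this) (fun j => (y j : ℂ))
  simp only [norm_real, Real.norm_eq_abs, sq_abs] at h
  rw [← h]
  simp [Matrix.mulVec, dotProduct, skewVandermonde, skewFourier, mul_comm]

theorem conj_skewFourier (n : ℕ) (y : ℕ → ℝ) (k : Fin n) :
    conj (skewFourier n y k) = skewFourier n y k.rev := by
  simp [skewFourier, conj_skewRoot]

theorem skewFourier_sub (n : ℕ) (y z : ℕ → ℝ) (k : Fin n) :
    skewFourier n (y - z) k = skewFourier n y k - skewFourier n z k := by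
  simp [skewFourier, sub_mul]

theorem leftSkewCirculant_smul (n : ℕ) (c : ℝ) (y : ℕ → ℝ) :
    leftSkewCirculant n (c • y) = c • leftSkewCirculant n y := by
  ext i j
  simp only [leftSkewCirculant, Matrix.of_apply, Matrix.smul_apply, Pi.smul_apply, smul_eq_mul]
  split_ifs <;> ring

/-- The left skew-circulant matrix maps the power vector of a root to a multiple of the power
vector of the conjugate root. -/
theorem leftSkewCirculant_mulVec_skewRoot (n : ℕ) (y : ℕ → ℝ) (k i : Fin n) :
    ∑ j : Fin n, (leftSkewCirculant n y i j : ℂ) * skewRoot n k ^ (j : ℕ)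
      = skewRoot n k.rev ^ (i : ℕ) * skewFourier n y k := by
  have hz : skewRoot n k ^ (i : ℕ) * skewRoot n k.rev ^ (i : ℕ) = 1 := by
    rw [← mul_pow, ← conj_skewRoot, skewRoot_mul_conj, one_pow]
  have hz0 : skewRoot n k ^ (i : ℕ) ≠ 0 := pow_ne_zero _ (skewRoot_ne_zero n k)
  apply mul_left_cancel₀ hz0
  rw [← mul_assoc, hz, one_mul, skewFourier, Finset.mul_sum]
  have : NeZero n := ⟨(Fin.pos k).ne'⟩
  -- Shift the transform cyclically by `i`. On wrapping around modulo `n`, the factor ζ^n = -1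
  -- matches the minus sign of the matrix entry.
  rw [← Equiv.sum_comp (Equiv.addLeft i) (fun j : Fin n => (y j : ℂ) * skewRoot n k ^ (j : ℕ))]
  refine Finset.sum_congr rfl fun j _ => ?_
  simp only [leftSkewCirculant, Matrix.of_apply, Equiv.coe_addLeft, Fin.val_add]
  have hi := i.2
  have hj := j.2
  split_ifs with h
  · rw [Nat.mod_eq_of_lt h, pow_add]
    ring
  · rw [Nat.mod_eq_sub_mod (by omega), Nat.mod_eq_of_lt (by omega : (i : ℕ) + j - n < n)]
    have : skewRoot n k ^ (i : ℕ) * skewRoot n k ^ (j : ℕ)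
        = - skewRoot n k ^ ((i : ℕ) + j - n) := by
      rw [← pow_add]
      conv_lhs => rw [show (i : ℕ) + j = ((i : ℕ) + j - n) + n by omega]
      rw [pow_add, skewRoot_pow_self]
      ring
    push_cast
    linear_combination (-(y ((i : ℕ) + j - n) : ℂ)) * this

/-- The matrix of the left skew-circulant in the basis of power vectors. -/
noncomputable def skewFourierMatrix (n : ℕ) (y : ℕ → ℝ) : Matrix (Fin n) (Fin n) ℂ :=
  Matrix.of fun a k => if a = k.rev then skewFourier n y k else 0

theorem leftSkewCirculant_mul_skewVandermonde (n : ℕ) (y : ℕ → ℝ) :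
    (leftSkewCirculant n y).map ofReal * skewVandermonde n
      = skewVandermonde n * skewFourierMatrix n y := by
  ext i k
  simp only [Matrix.mul_apply, Matrix.map_apply, skewVandermonde, Matrix.of_apply,
    skewFourierMatrix, mul_ite, mul_zero, Finset.sum_ite_eq', Finset.mem_univ, if_true]
  exact leftSkewCirculant_mulVec_skewRoot n y k i

theorem leftSkewCirculant_pow_mul_skewVandermonde (n : ℕ) (y : ℕ → ℝ) (p : ℕ) :
    ((leftSkewCirculant n y).map ofReal) ^ p * skewVandermonde n
      = skewVandermonde n * skewFourierMatrix n y ^ p := by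
  induction p with
  | zero => simp
  | succ p ih =>
    rw [pow_succ, mul_assoc, leftSkewCirculant_mul_skewVandermonde, ← mul_assoc, ih, mul_assoc,
      ← pow_succ]

/-- The two matrices are similar through `skewVandermonde`, which is unitary up to the scalar √n;
cyclicity of the trace does the rest. -/
theorem trace_leftSkewCirculant_pow (n : ℕ) (y : ℕ → ℝ) (p : ℕ) :
    (((leftSkewCirculant n y).map ofReal) ^ p).trace = (skewFourierMatrix n y ^ p).trace := by
  rcases Nat.eq_zero_or_pos n with rfl | hpos
  · simp
  have hn : (n : ℂ) ≠ 0 := Nat.cast_ne_zero.2 hpos.ne'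
  apply mul_left_cancel₀ hn
  have e : ∀ M : Matrix (Fin n) (Fin n) ℂ, (n : ℂ) * M.trace = (((n : ℂ) • 1) * M).trace := by
    intro M; simp [Matrix.trace_smul]
  rw [e, e, ← skewVandermonde_mul_conjTranspose, Matrix.trace_mul_comm, ← mul_assoc,
    leftSkewCirculant_pow_mul_skewVandermonde, Matrix.trace_mul_comm, ← mul_assoc,
    skewVandermonde_conjTranspose_mul, skewVandermonde_mul_conjTranspose]

/-- Applying the reversal twice returns to the same root and picks up Λ at a root and at its
conjugate; for real input these are conjugate numbers. -/
theorem skewFourierMatrix_sq (n : ℕ) (y : ℕ → ℝ) :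
    skewFourierMatrix n y ^ 2 = Matrix.diagonal fun k => ((‖skewFourier n y k‖ ^ 2 : ℝ) : ℂ) := by
  ext a k
  simp only [sq, Matrix.mul_apply, skewFourierMatrix, Matrix.of_apply, Matrix.diagonal_apply,
    ite_mul, zero_mul, mul_ite, mul_zero, Finset.sum_ite_eq', Finset.mem_univ, if_true,
    Fin.rev_rev]
  split_ifs with h
  · subst h
    rw [← conj_skewFourier, conj_mul']
    push_cast
    ring
  · rfl

theorem trace_leftSkewCirculant_pow_even (n : ℕ) (y : ℕ → ℝ) (m : ℕ) :
    (((leftSkewCirculant n y).map ofReal) ^ (2 * m)).trace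
      = ∑ k, ((‖skewFourier n y k‖ ^ (2 * m) : ℝ) : ℂ) := by
  rw [trace_leftSkewCirculant_pow, pow_mul, skewFourierMatrix_sq, Matrix.diagonal_pow,
    Matrix.trace_diagonal]
  refine Finset.sum_congr rfl fun k _ => ?_
  simp [pow_mul]

/-- An odd power is a diagonal matrix composed with the reversal, so only self-conjugate roots reach
the diagonal. There Λ is real, which is why `re` loses nothing. -/
theorem trace_leftSkewCirculant_pow_odd (n : ℕ) (y : ℕ → ℝ) (m : ℕ) :
    (((leftSkewCirculant n y).map ofReal) ^ (2 * m + 1)).trace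
      = ∑ k, if k = k.rev then (((skewFourier n y k).re ^ (2 * m + 1) : ℝ) : ℂ) else 0 := by
  rw [trace_leftSkewCirculant_pow, pow_succ', pow_mul, skewFourierMatrix_sq, Matrix.diagonal_pow,
    Matrix.trace]
  refine Finset.sum_congr rfl fun k _ => ?_
  rw [Matrix.diag_apply, Matrix.mul_diagonal, skewFourierMatrix, Matrix.of_apply]
  split_ifs with h
  · have h1 : conj (skewFourier n y k) = skewFourier n y k := by rw [conj_skewFourier, ← h]
    obtain ⟨r, hr⟩ := conj_eq_iff_real.1 h1
    simp only [hr, norm_real, Real.norm_eq_abs, sq_abs, Pi.pow_apply, ofReal_re]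
    push_cast
    ring
  · simp

theorem card_filter_eq_rev_le_one (n : ℕ) :
    (Finset.univ.filter fun k : Fin n => k = k.rev).card ≤ 1 := by
  rw [Finset.card_le_one]
  intro a ha b hb
  simp only [Finset.mem_filter, Finset.mem_univ, true_and, Fin.ext_iff, Fin.val_rev] at ha hb
  ext
  omega

end SkewFourier

/-! ### Linear statistics of the spectrum. -/

section SpectralSums

open Complex ComplexConjugate

theorem Matrix.IsHermitian.trace_pow_eq_sum_eigenvalues {m : Type*} [Fintype m] [DecidableEq m]
    {A : Matrix m m ℝ} (hA : A.IsHermitian) (p : ℕ) :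
    (A ^ p).trace = ∑ j, hA.eigenvalues j ^ p := by
  conv_lhs => rw [hA.spectral_theorem, ← map_pow, Unitary.conjStarAlgAut_apply,
    Matrix.trace_mul_comm, ← mul_assoc, Unitary.coe_star_mul_self, one_mul, Matrix.diagonal_pow,
    Matrix.trace_diagonal]
  simp

/-- Halving at every non-real root avoids choosing a representative of each conjugate pair: both
members have the same |Λ|, and together they account for one copy of each of ±|Λ|. -/
theorem sum_pow_eigenvalues_leftSkewCirculant (n : ℕ) (y : ℕ → ℝ)
    (hA : (leftSkewCirculant n y).IsHermitian) (p : ℕ) :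
    ∑ j, hA.eigenvalues j ^ p = ∑ k : Fin n, if k = k.rev then (skewFourier n y k).re ^ p
      else (‖skewFourier n y k‖ ^ p + (-‖skewFourier n y k‖) ^ p) / 2 := by
  have h : ((leftSkewCirculant n y ^ p).trace : ℂ)
      = (((leftSkewCirculant n y).map ofReal) ^ p).trace := by
    have h1 : ((leftSkewCirculant n y).map ofReal) ^ p = (leftSkewCirculant n y ^ p).map ofReal :=
      (map_pow (ofRealHom.mapMatrix) (leftSkewCirculant n y) p).symm
    rw [h1]
    simp [Matrix.trace]
  rw [← hA.trace_pow_eq_sum_eigenvalues]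
  obtain ⟨m, rfl | rfl⟩ := p.even_or_odd'
  · rw [trace_leftSkewCirculant_pow_even] at h
    have h' : (leftSkewCirculant n y ^ (2 * m)).trace = ∑ k, ‖skewFourier n y k‖ ^ (2 * m) := by
      exact_mod_cast h
    rw [h']
    refine Finset.sum_congr rfl fun k _ => ?_
    split_ifs with hk
    · have h1 : conj (skewFourier n y k) = skewFourier n y k := by rw [conj_skewFourier, ← hk]
      obtain ⟨r, hr⟩ := conj_eq_iff_real.1 h1
      rw [hr, pow_mul, pow_mul]
      simp
    · rw [pow_mul, pow_mul, neg_sq]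
      ring
  · rw [trace_leftSkewCirculant_pow_odd] at h
    have h' : (leftSkewCirculant n y ^ (2 * m + 1)).trace
        = ∑ k : Fin n, if k = k.rev then (skewFourier n y k).re ^ (2 * m + 1) else 0 := by
      apply ofReal_injective
      rw [h, ofReal_sum]
      refine Finset.sum_congr rfl fun k _ => ?_
      split_ifs <;> simp
    rw [h']
    refine Finset.sum_congr rfl fun k _ => ?_
    split_ifs with hk
    · rfl
    · rw [Odd.neg_pow ⟨m, rfl⟩]
      ring

/-- The spectrum of a left skew-circulant matrix: for each conjugate pair of roots of `-1` the two
eigenvalues `± |Λ|`, and for the real root the eigenvalue `Λ`. -/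
theorem sum_comp_eigenvalues_leftSkewCirculant (n : ℕ) (y : ℕ → ℝ)
    (hA : (leftSkewCirculant n y).IsHermitian) (f : ℝ → ℝ) :
    ∑ j, f (hA.eigenvalues j) = ∑ k : Fin n, if k = k.rev then f (skewFourier n y k).re
      else (f ‖skewFourier n y k‖ + f (-‖skewFourier n y k‖)) / 2 := by
  have hpoly : ∀ q : Polynomial ℝ, ∑ j, q.eval (hA.eigenvalues j)
      = ∑ k : Fin n, if k = k.rev then q.eval (skewFourier n y k).re
      else (q.eval ‖skewFourier n y k‖ + q.eval (-‖skewFourier n y k‖)) / 2 := by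
    intro q
    induction q using Polynomial.induction_on' with
    | add p q hp hq =>
      simp only [Polynomial.eval_add, Finset.sum_add_distrib, hp, hq]
      rw [← Finset.sum_add_distrib]
      refine Finset.sum_congr rfl fun k _ => ?_
      split_ifs <;> ring
    | monomial p a =>
      simp only [Polynomial.eval_monomial]
      rw [← Finset.mul_sum, sum_pow_eigenvalues_leftSkewCirculant, Finset.mul_sum]
      refine Finset.sum_congr rfl fun k _ => ?_
      split_ifs <;> ring
  classical
  -- All points at which `f` is evaluated. On this finite set `f` agrees with its Lagrange
  -- interpolant, so the polynomial case suffices and no eigenvectors need be matched up.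
  let s : Finset ℝ := Finset.univ.image hA.eigenvalues ∪
    (Finset.univ.image (fun k => (skewFourier n y k).re) ∪
    (Finset.univ.image (fun k => ‖skewFourier n y k‖) ∪
      Finset.univ.image fun k => -‖skewFourier n y k‖))
  have hq : ∀ x ∈ s, (Lagrange.interpolate s id f).eval x = f x := fun x hx =>
    Lagrange.eval_interpolate_at_node f (Set.injOn_id _) hx
  have hs := hpoly (Lagrange.interpolate s id f)
  have e1 : ∀ j, hA.eigenvalues j ∈ s := fun j => by simp [s]
  have e2 : ∀ k, (skewFourier n y k).re ∈ s := fun k => by simp [s]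
  have e3 : ∀ k, ‖skewFourier n y k‖ ∈ s := fun k => by simp [s]
  have e4 : ∀ k, -‖skewFourier n y k‖ ∈ s := fun k => by simp [s]
  simpa only [hq _ (e1 _), hq _ (e2 _), hq _ (e3 _), hq _ (e4 _)] using hs

/-- The two sums differ only at the real root, if there is one. The bound does not depend on `n`, so
it disappears from the normalized spectral distribution. -/
theorem abs_sum_comp_eigenvalues_sub_le (n : ℕ) (y : ℕ → ℝ)
    (hA : (leftSkewCirculant n y).IsHermitian) (f : ℝ → ℝ) (C : ℝ) (hC : ∀ x, |f x| ≤ C) :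
    |∑ j, f (hA.eigenvalues j)
      - ∑ k : Fin n, (f ‖skewFourier n y k‖ + f (-‖skewFourier n y k‖)) / 2| ≤ 2 * C := by
  have hC0 : 0 ≤ C := (abs_nonneg _).trans (hC 0)
  rw [sum_comp_eigenvalues_leftSkewCirculant, ← Finset.sum_sub_distrib]
  calc _ ≤ ∑ k : Fin n, if k = k.rev then 2 * C else 0 := by
        refine (Finset.abs_sum_le_sum_abs _ _).trans (Finset.sum_le_sum fun k _ => ?_)
        split_ifs with hk
        · have h1 := abs_le.1 (hC (skewFourier n y k).re)
          have h2 := abs_le.1 (hC ‖skewFourier n y k‖)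
          have h3 := abs_le.1 (hC (-‖skewFourier n y k‖))
          rw [abs_le]
          constructor <;> linarith
        · simp
    _ = (Finset.univ.filter fun k : Fin n => k = k.rev).card * (2 * C) := by
        rw [← Finset.sum_filter, Finset.sum_const, nsmul_eq_mul]
    _ ≤ 1 * (2 * C) := by
        gcongr
        exact_mod_cast card_filter_eq_rev_le_one n
    _ = 2 * C := one_mul _

end SpectralSums

/-! ### The standard complex Gaussian and the symmetrized Rayleigh law. -/

section GaussianLaw

open Complex ComplexConjugate

theorem integral_exp_neg_norm_sq_complex : ∫ z : ℂ, Real.exp (-‖z‖ ^ 2) = Real.pi := by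
  have h := GaussianFourier.integral_rexp_neg_mul_sq_norm (V := ℂ) one_pos
  simpa using h

theorem integrable_exp_neg_norm_sq_complex : Integrable fun z : ℂ => Real.exp (-‖z‖ ^ 2) := by
  -- The Bochner integral of a non-integrable function is 0 by default, so a nonzero value already
  -- proves integrability.
  refine .of_integral_ne_zero ?_
  rw [integral_exp_neg_norm_sq_complex]
  exact Real.pi_ne_zero

/-- The standard complex Gaussian law, with density `π⁻¹ exp (-|z|²)` on `ℂ`. -/
noncomputable def complexGaussian : ProbabilityMeasure ℂ :=
  ⟨volume.withDensity fun z : ℂ => ENNReal.ofReal (Real.pi⁻¹ * Real.exp (-‖z‖ ^ 2)), ⟨by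
    rw [withDensity_apply _ MeasurableSet.univ, Measure.restrict_univ,
      ← ofReal_integral_eq_lintegral_ofReal (integrable_exp_neg_norm_sq_complex.const_mul _)
        (Eventually.of_forall fun x => by positivity), integral_const_mul,
      integral_exp_neg_norm_sq_complex, inv_mul_cancel₀ Real.pi_ne_zero, ENNReal.ofReal_one]⟩⟩

theorem integral_complexGaussian {E : Type*} [NormedAddCommGroup E] [NormedSpace ℝ E] (f : ℂ → E) :
    ∫ z, f z ∂(complexGaussian : Measure ℂ)
      = ∫ z : ℂ, (Real.pi⁻¹ * Real.exp (-‖z‖ ^ 2)) • f z := by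
  change ∫ z, f z ∂(volume.withDensity _) = _
  rw [integral_withDensity_eq_integral_toReal_smul (by fun_prop)
    (Eventually.of_forall fun _ => ENNReal.ofReal_lt_top)]
  refine integral_congr_ae (Eventually.of_forall fun z => ?_)
  beta_reduce
  rw [ENNReal.toReal_ofReal (by positivity)]

theorem charFun_complexGaussian (t : ℂ) :
    charFun (complexGaussian : Measure ℂ) t = Complex.exp (-‖t‖ ^ 2 / 4) := by
  have h := GaussianFourier.integral_cexp_neg_mul_sq_norm_add (V := ℂ) (b := 1) (by simp) I t
  rw [charFun_apply, integral_complexGaussian]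
  have e : ∀ z : ℂ, (Real.pi⁻¹ * Real.exp (-‖z‖ ^ 2)) • Complex.exp ((inner ℝ z t : ℝ) * I)
      = (Real.pi : ℂ)⁻¹ * Complex.exp (-1 * ‖z‖ ^ 2 + I * (inner ℝ t z : ℝ)) := by
    intro z
    rw [Complex.exp_add, real_inner_comm, real_smul]
    push_cast
    ring_nf
  simp_rw [e]
  rw [integral_const_mul, h]
  simp only [finrank_real_complex, Nat.cast_ofNat, div_one, I_sq]
  rw [div_self two_ne_zero, cpow_one, ← mul_assoc,
    inv_mul_cancel₀ (by simp [Real.pi_ne_zero]), one_mul]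
  congr 1
  ring

/-- Polar coordinates: the factor 2 is the dimension, the area π of the unit disc cancelling the π⁻¹
of the density. -/
theorem integral_norm_complexGaussian (f : ℝ → ℝ) :
    ∫ z, f ‖z‖ ∂(complexGaussian : Measure ℂ)
      = 2 * ∫ r in Set.Ioi (0 : ℝ), r * Real.exp (-r ^ 2) * f r := by
  rw [integral_complexGaussian]
  have h := integral_fun_norm_addHaar (volume : Measure ℂ)
    (fun r : ℝ => (Real.pi⁻¹ * Real.exp (-r ^ 2)) * f r)
  simp only [smul_eq_mul] at h ⊢
  rw [h]
  have hb : (volume : Measure ℂ).real (Metric.ball 0 1) = Real.pi := by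
    simp [measureReal_def, Complex.volume_ball]
  rw [hb, finrank_real_complex, ← integral_const_mul, nsmul_eq_mul, ← integral_const_mul,
    ← integral_const_mul]
  refine integral_congr_ae (Eventually.of_forall fun r => ?_)
  have := Real.pi_ne_zero
  simp
  field_simp

theorem integral_symmetrizedRayleigh (f : ℝ → ℝ) :
    ∫ x, f x ∂(symmetrizedRayleigh : Measure ℝ) = ∫ x : ℝ, |x| * Real.exp (-x ^ 2) * f x := by
  change ∫ z, f z ∂(volume.withDensity _) = _
  rw [integral_withDensity_eq_integral_toReal_smul (by fun_prop)
    (Eventually.of_forall fun _ => ENNReal.ofReal_lt_top)]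
  refine integral_congr_ae (Eventually.of_forall fun z => ?_)
  beta_reduce
  rw [ENNReal.toReal_ofReal (by positivity), smul_eq_mul]

theorem integrable_abs_pow_mul_exp_neg_sq (m : ℕ) :
    Integrable fun x : ℝ => |x| ^ m * Real.exp (-x ^ 2) := by
  have h := (integrable_rpow_mul_exp_neg_mul_sq (b := 1) one_pos (s := m)
    (by have : (0 : ℝ) ≤ m := m.cast_nonneg
        linarith)).abs
  refine h.congr (Eventually.of_forall fun x => ?_)
  simp [abs_mul, abs_pow]

theorem memLp_id_symmetrizedRayleigh (p : ℕ) :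
    MemLp (fun x : ℝ => x) p (symmetrizedRayleigh : Measure ℝ) := by
  rcases Nat.eq_zero_or_pos p with rfl | hp
  · simpa using measurable_id'.aestronglyMeasurable
  rw [← integrable_norm_rpow_iff measurable_id'.aestronglyMeasurable (by exact_mod_cast hp.ne')
    (by simp)]
  change Integrable _ (volume.withDensity _)
  rw [integrable_withDensity_iff_integrable_smul' (by fun_prop)
      (Eventually.of_forall fun _ => ENNReal.ofReal_lt_top)]
  refine (integrable_abs_pow_mul_exp_neg_sq (p + 1)).congr (Eventually.of_forall fun x => ?_)
  beta_reduce
  rw [ENNReal.toReal_ofReal (by positivity)]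
  simp
  ring

/-- The symmetrized Rayleigh law is that of a fair independent sign times the modulus of a standard
complex Gaussian. The half-sum is the form in which the spectrum of the matrix appears. -/
theorem integral_symmetrizedRayleigh_eq_complexGaussian (f : ℝ → ℝ)
    (hf : Integrable f (symmetrizedRayleigh : Measure ℝ)) :
    ∫ x, f x ∂(symmetrizedRayleigh : Measure ℝ)
      = ∫ z, (f ‖z‖ + f (-‖z‖)) / 2 ∂(complexGaussian : Measure ℂ) := by
  rw [integral_norm_complexGaussian (fun r => (f r + f (-r)) / 2), integral_symmetrizedRayleigh]
  have hint : Integrable fun x : ℝ => |x| * Real.exp (-x ^ 2) * f x := by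
    have h1 : Integrable f (volume.withDensity _) := hf
    rw [integrable_withDensity_iff_integrable_smul' (by fun_prop)
      (Eventually.of_forall fun _ => ENNReal.ofReal_lt_top)] at h1
    refine h1.congr (Eventually.of_forall fun x => ?_)
    beta_reduce
    rw [ENNReal.toReal_ofReal (by positivity), smul_eq_mul]
  have hiic := integral_comp_neg_Ioi 0 (fun x => |x| * Real.exp (-x ^ 2) * f x)
  rw [neg_zero] at hiic
  rw [← intervalIntegral.integral_Iic_add_Ioi (b := 0) hint.integrableOn hint.integrableOn, ← hiic]
  have hneg : IntegrableOn (fun x : ℝ => |-x| * Real.exp (-(-x) ^ 2) * f (-x)) (Set.Ioi 0) :=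
    hint.comp_neg.integrableOn
  rw [← integral_add hneg hint.integrableOn, ← integral_const_mul]
  refine setIntegral_congr_fun measurableSet_Ioi fun r hr => ?_
  have hr' : (0 : ℝ) < r := hr
  simp only [abs_neg, abs_of_pos hr', neg_sq]
  ring

theorem integral_pow_even_symmetrizedRayleigh (m : ℕ) :
    ∫ x, x ^ (2 * m) ∂(symmetrizedRayleigh : Measure ℝ) = m.factorial := by
  rw [integral_symmetrizedRayleigh]
  have h1 : ∫ x : ℝ, |x| * Real.exp (-x ^ 2) * x ^ (2 * m)
      = ∫ x : ℝ, |x| * Real.exp (-|x| ^ 2) * |x| ^ (2 * m) := by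
    simp [pow_mul]
  rw [h1, integral_comp_abs (f := fun x => x * Real.exp (-x ^ 2) * x ^ (2 * m))]
  have h := _root_.integral_rpow_mul_exp_neg_rpow (p := 2) (q := 2 * m + 1) (by norm_num)
    (by have : (0 : ℝ) ≤ m := m.cast_nonneg
        linarith)
  have h2 : ((2 * m + 1 + 1) / 2 : ℝ) = m + 1 := by ring
  rw [h2, Real.Gamma_nat_eq_factorial] at h
  have h3 : ∫ x in Set.Ioi (0 : ℝ), x * Real.exp (-x ^ 2) * x ^ (2 * m)
      = ∫ x in Set.Ioi (0 : ℝ), x ^ (2 * m + 1 : ℝ) * Real.exp (-x ^ (2 : ℝ)) := by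
    refine setIntegral_congr_fun measurableSet_Ioi fun r hr => ?_
    have : (r : ℝ) ^ (2 * m + 1 : ℝ) = r ^ (2 * m + 1) := by
      rw [← Real.rpow_natCast]; push_cast; rfl
    simp only [this, Real.rpow_ofNat]
    ring
  rw [h3, h]
  ring

theorem integral_pow_odd_symmetrizedRayleigh (m : ℕ) :
    ∫ x, x ^ (2 * m + 1) ∂(symmetrizedRayleigh : Measure ℝ) = 0 := by
  rw [integral_symmetrizedRayleigh]
  have h := integral_neg_eq_self (fun x : ℝ => |x| * Real.exp (-x ^ 2) * x ^ (2 * m + 1)) volume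
  have h2 : ∀ x : ℝ, |-x| * Real.exp (-(-x) ^ 2) * (-x) ^ (2 * m + 1)
      = -(|x| * Real.exp (-x ^ 2) * x ^ (2 * m + 1)) := by
    intro x
    rw [abs_neg, neg_sq, Odd.neg_pow ⟨m, rfl⟩]
    ring
  simp_rw [h2] at h
  rw [integral_neg] at h
  linarith

theorem integral_norm_pow_complexGaussian (m : ℕ) :
    ∫ z, ‖z‖ ^ (2 * m) ∂(complexGaussian : Measure ℂ) = m.factorial := by
  rw [← integral_pow_even_symmetrizedRayleigh,
    integral_symmetrizedRayleigh_eq_complexGaussian (fun x => x ^ (2 * m))]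
  · refine integral_congr_ae (Eventually.of_forall fun z => ?_)
    simp only [pow_mul, neg_sq]
    ring
  · have := (memLp_id_symmetrizedRayleigh (2 * m)).integrable_norm_pow'
    refine this.congr (Eventually.of_forall fun x => ?_)
    simp [pow_mul]

theorem integrable_norm_pow_complexGaussian (m : ℕ) :
    Integrable (fun z => ‖z‖ ^ (2 * m)) (complexGaussian : Measure ℂ) := by
  refine .of_integral_ne_zero ?_
  rw [integral_norm_pow_complexGaussian]
  exact_mod_cast m.factorial_ne_zero

end GaussianLaw

/-! ### A quantitative central limit theorem for the Fourier coefficients. -/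

section CentralLimit

open Complex ComplexConjugate

/-- Telescoping: replace the factors one at a time, the remaining ones having norm at most 1. -/
theorem norm_prod_sub_prod_le_sum {ι : Type*} (s : Finset ι) (a b : ι → ℂ)
    (ha : ∀ i ∈ s, ‖a i‖ ≤ 1) (hb : ∀ i ∈ s, ‖b i‖ ≤ 1) :
    ‖∏ i ∈ s, a i - ∏ i ∈ s, b i‖ ≤ ∑ i ∈ s, ‖a i - b i‖ := by
  classical
  induction s using Finset.induction_on with
  | empty => simp
  | insert i s hi ih =>
    have ha' : ∀ j ∈ s, ‖a j‖ ≤ 1 := fun j hj => ha j (Finset.mem_insert_of_mem hj)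
    have hb' : ∀ j ∈ s, ‖b j‖ ≤ 1 := fun j hj => hb j (Finset.mem_insert_of_mem hj)
    rw [Finset.prod_insert hi, Finset.prod_insert hi, Finset.sum_insert hi]
    have e : a i * ∏ j ∈ s, a j - b i * ∏ j ∈ s, b j
        = (a i - b i) * ∏ j ∈ s, a j + b i * (∏ j ∈ s, a j - ∏ j ∈ s, b j) := by ring
    rw [e]
    refine (norm_add_le _ _).trans (add_le_add ?_ ?_)
    · rw [norm_mul]
      refine mul_le_of_le_one_right (norm_nonneg _) ?_
      rw [norm_prod]
      exact Finset.prod_le_one (fun j _ => norm_nonneg _) ha'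
    · rw [norm_mul]
      exact (mul_le_of_le_one_left (norm_nonneg _) (hb i (Finset.mem_insert_self i s))).trans
        (ih ha' hb')

/-- Taylor's bound for |x| ≤ 1. Beyond that, the crude estimate 2 + |x| + |x|²/2 is at most
(7/2)|x|³. Validity on all of ℝ allows integration against any law with a third moment. -/
theorem norm_exp_mul_I_sub_quadratic_le (x : ℝ) :
    ‖exp (x * I) - (1 + x * I - x ^ 2 / 2)‖ ≤ 4 * |x| ^ 3 := by
  have hx0 := abs_nonneg x
  rcases le_or_gt |x| 1 with hx | hx
  · have h := exp_bound (x := x * I) (by simpa using hx) (n := 3) (by norm_num)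
    have e : ∑ m ∈ Finset.range 3, (x * I : ℂ) ^ m / (m.factorial : ℂ) = 1 + x * I - x ^ 2 / 2 := by
      simp [Finset.sum_range_succ, mul_pow, Nat.factorial]
      ring
    rw [e] at h
    refine h.trans ?_
    simp only [norm_mul, norm_real, Real.norm_eq_abs, norm_I, mul_one]
    have h3 : 0 ≤ |x| ^ 3 := by positivity
    norm_num [Nat.factorial]
    linarith
  · have h1 : ‖exp (x * I) - (1 + x * I - x ^ 2 / 2)‖ ≤ 1 + (1 + |x| + |x| ^ 2 / 2) := by
      refine (norm_sub_le _ _).trans (add_le_add (norm_exp_ofReal_mul_I x).le ?_)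
      refine (norm_sub_le _ _).trans (add_le_add ((norm_add_le _ _).trans ?_) ?_)
      · simp
      · simp
    have h2 : |x| ≤ |x| ^ 3 := le_self_pow₀ hx.le (by norm_num)
    have h3 : |x| ^ 2 ≤ |x| ^ 3 := pow_le_pow_right₀ hx.le (by norm_num)
    linarith

theorem abs_exp_neg_sub_one_sub_le {u : ℝ} (hu : 0 ≤ u) : |Real.exp (-u) - (1 - u)| ≤ u ^ 2 := by
  rcases le_or_gt u 1 with h | h
  · have := Real.abs_exp_sub_one_sub_id_le (x := -u) (by rwa [abs_neg, abs_of_nonneg hu])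
    rw [neg_sq] at this
    convert this using 2
    ring
  · have h1 := Real.one_sub_le_exp_neg u
    have h2 : Real.exp (-u) ≤ 1 := Real.exp_le_one_iff.2 (by linarith)
    rw [abs_of_nonneg (by linarith)]
    nlinarith

variable {Ω : Type*} [MeasurableSpace Ω]

/-- Independent centred random variables with common second moment `v` and third absolute moments
bounded by `C`. -/
structure CenteredThirdMoment (l : ℕ → Ω → ℝ) (P : Measure Ω) (v C : ℝ) : Prop where
  measurable : ∀ j, Measurable (l j)
  indep : iIndepFun l P
  memLp : ∀ j, MemLp (l j) 3 P
  mean : ∀ j, ∫ ω, l j ω ∂P = 0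
  second : ∀ j, ∫ ω, l j ω ^ 2 ∂P = v
  third : ∀ j, ∫ ω, |l j ω| ^ 3 ∂P ≤ C

theorem norm_integral_exp_sub_quadratic_le {P : Measure Ω} [IsProbabilityMeasure P] {X : Ω → ℝ}
    (hX : MemLp X 3 P) (h0 : ∫ ω, X ω ∂P = 0) (b : ℝ) :
    ‖∫ ω, exp ((X ω * b : ℝ) * I) ∂P - ((1 - (∫ ω, X ω ^ 2 ∂P) * b ^ 2 / 2 : ℝ) : ℂ)‖
      ≤ 4 * |b| ^ 3 * ∫ ω, |X ω| ^ 3 ∂P := by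
  have hX1 : Integrable X P := hX.integrable (by norm_num)
  have hX2 : Integrable (fun ω => X ω ^ 2) P := by
    have := hX.mono_exponent (p := 2) (by norm_num)
    exact this.integrable_sq
  have hX3 : Integrable (fun ω => |X ω| ^ 3) P := hX.integrable_norm_pow (by norm_num)
  have hexp : Integrable (fun ω => exp ((X ω * b : ℝ) * I)) P := by
    refine Integrable.of_bound (C := 1) ?_
      (Eventually.of_forall fun ω => (norm_exp_ofReal_mul_I _).le)
    have := hX.aestronglyMeasurable.aemeasurable
    exact AEMeasurable.aestronglyMeasurable (by fun_prop)
  have hquad : Integrable (fun ω => (1 + (X ω * b : ℝ) * I - (X ω * b : ℝ) ^ 2 / 2 : ℂ)) P := by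
    refine ((integrable_const _).add ((hX1.mul_const b).ofReal.mul_const I)).sub ?_
    have := ((hX2.mul_const (b ^ 2 / 2)).ofReal (𝕜 := ℂ))
    refine this.congr (Eventually.of_forall fun ω => ?_)
    simp
    ring
  have hint : ∫ ω, (1 + (X ω * b : ℝ) * I - (X ω * b : ℝ) ^ 2 / 2 : ℂ) ∂P
      = ((1 - (∫ ω, X ω ^ 2 ∂P) * b ^ 2 / 2 : ℝ) : ℂ) := by
    have e : ∀ ω, (1 + (X ω * b : ℝ) * I - (X ω * b : ℝ) ^ 2 / 2 : ℂ)
        = 1 + ((X ω : ℝ) : ℂ) * (b * I) - ((X ω ^ 2 : ℝ) : ℂ) * (b ^ 2 / 2) := by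
      intro ω; push_cast; ring
    simp_rw [e]
    rw [integral_sub ((integrable_const _).add (hX1.ofReal.mul_const _)) (hX2.ofReal.mul_const _),
      integral_add (integrable_const _) (hX1.ofReal.mul_const _), integral_mul_const,
      integral_mul_const, integral_complex_ofReal, integral_complex_ofReal, h0]
    simp
    ring
  rw [← hint, ← integral_sub hexp hquad, ← integral_const_mul]
  refine (norm_integral_le_integral_norm _).trans ?_
  refine integral_mono (hexp.sub hquad).norm (hX3.const_mul _) fun ω => ?_
  refine (norm_exp_mul_I_sub_quadratic_le _).trans_eq ?_
  rw [abs_mul]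
  ring

/-- Lyapunov's argument: by independence both terms are products over `j`, and the two j-th factors
are both close to 1 - v b_j²/2. -/
theorem norm_integral_exp_sum_sub_gaussian_le {P : Measure Ω} [IsProbabilityMeasure P]
    {l : ℕ → Ω → ℝ} {v C : ℝ} (hl : CenteredThirdMoment l P v C) (n : ℕ) (b : Fin n → ℝ) :
    ‖∫ ω, exp ((∑ j : Fin n, l j ω * b j : ℝ) * I) ∂P
        - ((Real.exp (-(v * (∑ j, b j ^ 2) / 2)) : ℝ) : ℂ)‖
      ≤ ∑ j, (4 * C * |b j| ^ 3 + v ^ 2 * |b j| ^ 4 / 4) := by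
  have hv : 0 ≤ v := by
    rw [← hl.second 0]
    exact integral_nonneg fun ω => sq_nonneg _
  have hfin : iIndepFun (fun j : Fin n => l j) P := hl.indep.precomp Fin.val_injective
  have h1 : ∫ ω, exp ((∑ j : Fin n, l j ω * b j : ℝ) * I) ∂P
      = ∏ j : Fin n, ∫ ω, exp ((l j ω * b j : ℝ) * I) ∂P := by
    rw [← hfin.integral_fun_prod_comp (f := fun j x => exp ((x * b j : ℝ) * I))
      (fun j => (hl.measurable j).aemeasurable) (fun j => by fun_prop)]
    refine integral_congr_ae (Eventually.of_forall fun ω => ?_)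
    beta_reduce
    rw [← exp_sum, ← Finset.sum_mul]
    push_cast
    rfl
  have h2 : ((Real.exp (-(v * (∑ j, b j ^ 2) / 2)) : ℝ) : ℂ)
      = ∏ j, ((Real.exp (-(v * b j ^ 2 / 2)) : ℝ) : ℂ) := by
    rw [← ofReal_prod, ← Real.exp_sum, Finset.sum_neg_distrib, Finset.mul_sum, Finset.sum_div]
  rw [h1, h2]
  refine (norm_prod_sub_prod_le_sum _ _ _ (fun j _ => ?_) (fun j _ => ?_)).trans
    (Finset.sum_le_sum fun j _ => ?_)
  · refine (norm_integral_le_integral_norm _).trans ?_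
    simp_rw [norm_exp_ofReal_mul_I]
    simp
  · rw [norm_real, Real.norm_eq_abs, abs_of_pos (Real.exp_pos _), Real.exp_le_one_iff]
    have : 0 ≤ v * b j ^ 2 / 2 := by positivity
    linarith
  · have h3 := norm_integral_exp_sub_quadratic_le (hl.memLp j) (hl.mean j) (b j)
    rw [hl.second j] at h3
    have h4 := abs_exp_neg_sub_one_sub_le (u := v * b j ^ 2 / 2) (by positivity)
    have h5 : ‖((Real.exp (-(v * b j ^ 2 / 2)) : ℝ) : ℂ) - ((1 - v * b j ^ 2 / 2 : ℝ) : ℂ)‖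
        ≤ (v * b j ^ 2 / 2) ^ 2 := by
      rw [← ofReal_sub, norm_real]
      exact h4
    rw [norm_sub_rev] at h5
    refine (norm_sub_le_norm_sub_add_norm_sub _ _ _).trans ((add_le_add h3 h5).trans ?_)
    have h6 : 4 * |b j| ^ 3 * ∫ ω, |l j ω| ^ 3 ∂P ≤ 4 * |b j| ^ 3 * C := by
      gcongr
      exact hl.third j
    have h7 : |b j| ^ 4 = b j ^ 4 := Even.pow_abs ⟨2, rfl⟩ _
    rw [h7]
    nlinarith

/-- The Fourier transform at the roots of `-1`, normalized by `n^{-1/2}`. -/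
noncomputable def normalizedSkewFourier (n : ℕ) (y : ℕ → ℝ) (k : Fin n) : ℂ :=
  skewFourier n ((Real.sqrt n)⁻¹ • y) k

theorem normalizedLeftSkewCirculant_eq (n : ℕ) (y : ℕ → ℝ) :
    normalizedLeftSkewCirculant n y = leftSkewCirculant n ((Real.sqrt n)⁻¹ • y) := by
  rw [leftSkewCirculant_smul, normalizedLeftSkewCirculant]

/-- The coefficients of the linear form `y ↦ ⟪Λₖ(y), t⟫`. -/
noncomputable def skewCoeff (n : ℕ) (k : Fin n) (t : ℂ) (j : Fin n) : ℝ :=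
  (Real.sqrt n)⁻¹ * inner ℝ (skewRoot n k ^ (j : ℕ)) t

theorem inner_normalizedSkewFourier (n : ℕ) (y : ℕ → ℝ) (k : Fin n) (t : ℂ) :
    inner ℝ (normalizedSkewFourier n y k) t = ∑ j : Fin n, y j * skewCoeff n k t j := by
  simp only [normalizedSkewFourier, skewFourier, sum_inner, skewCoeff]
  refine Finset.sum_congr rfl fun j _ => ?_
  rw [← real_smul, real_inner_smul_left]
  simp
  ring

theorem abs_skewCoeff_le (n : ℕ) (k : Fin n) (t : ℂ) (j : Fin n) :
    |skewCoeff n k t j| ≤ (Real.sqrt n)⁻¹ * ‖t‖ := by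
  rw [skewCoeff, abs_mul, abs_of_nonneg (by positivity)]
  gcongr
  refine (abs_real_inner_le_norm _ _).trans_eq ?_
  rw [norm_pow, norm_skewRoot, one_pow, one_mul]

/-- Orthogonality of a root to its conjugate. This vanishing pseudo-variance makes the Gaussian
limit rotation invariant; it fails at the root -1. -/
theorem sum_skewRoot_sq_pow (n : ℕ) (k : Fin n) (hk : k ≠ k.rev) :
    ∑ j : Fin n, conj (skewRoot n k ^ (j : ℕ)) ^ 2 = 0 := by
  have h := sum_skewRoot_pow_mul_conj n k k.rev
  rw [if_neg hk] at h
  rw [← h]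
  refine Finset.sum_congr rfl fun j _ => ?_
  rw [← conj_skewRoot, sq, map_pow]

/-- Write the squared inner product as ‖t‖²/2 plus an oscillating term; the latter sums to zero by
`sum_skewRoot_sq_pow`. The variance is then the same in every direction of `t`. -/
theorem sum_skewCoeff_sq (n : ℕ) (k : Fin n) (hk : k ≠ k.rev) (t : ℂ) :
    ∑ j, skewCoeff n k t j ^ 2 = ‖t‖ ^ 2 / 2 := by
  have hn : (n : ℝ) ≠ 0 := Nat.cast_ne_zero.2 (Fin.pos k).ne'
  have e : ∀ j : Fin n, (inner ℝ (skewRoot n k ^ (j : ℕ)) t : ℝ) ^ 2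
      = ‖t‖ ^ 2 / 2 + (t ^ 2 * conj (skewRoot n k ^ (j : ℕ)) ^ 2).re / 2 := by
    intro j
    have h1 : ‖t‖ ^ 2 = ‖conj (skewRoot n k ^ (j : ℕ)) * t‖ ^ 2 := by
      simp [norm_skewRoot]
    rw [Complex.inner, ← mul_pow, mul_comm t, h1, ← normSq_eq_norm_sq, normSq_apply]
    simp only [sq (conj _ * t), mul_re (conj _ * t)]
    ring
  simp only [skewCoeff, mul_pow, e, mul_add, Finset.sum_add_distrib]
  have h0 : ∑ j : Fin n, (t ^ 2 * conj (skewRoot n k ^ (j : ℕ)) ^ 2).re / 2 = 0 := by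
    rw [← Finset.sum_div, ← re_sum, ← Finset.mul_sum, sum_skewRoot_sq_pow n k hk]
    simp
  rw [← Finset.mul_sum, ← Finset.mul_sum, h0]
  simp only [inv_pow, Nat.cast_nonneg, Real.sq_sqrt, Finset.sum_const, Finset.card_univ,
    Fintype.card_fin, nsmul_eq_mul, mul_zero, add_zero]
  field_simp

/-- There are n coefficients of size O(n^{-1/2}), so their third powers sum to O(n^{-1/2}) and their
fourth powers to O(n^{-1}). The bound is uniform in `k`, hence survives averaging. The variance `v`
is left free because truncation alters it. -/
theorem norm_integral_exp_inner_sub_le {P : Measure Ω} [IsProbabilityMeasure P]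
    {l : ℕ → Ω → ℝ} {v C : ℝ} (hl : CenteredThirdMoment l P v C) (n : ℕ) (k : Fin n)
    (hk : k ≠ k.rev) (t : ℂ) :
    ‖∫ ω, exp ((inner ℝ (normalizedSkewFourier n (fun j => l j ω) k) t : ℝ) * I) ∂P
        - ((Real.exp (-(v * ‖t‖ ^ 2 / 4)) : ℝ) : ℂ)‖
      ≤ 4 * C * ‖t‖ ^ 3 * (Real.sqrt n)⁻¹ + v ^ 2 * ‖t‖ ^ 4 / 4 * (n : ℝ)⁻¹ := by
  have hn : (0 : ℝ) < n := Nat.cast_pos.2 (Fin.pos k)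
  have hC : 0 ≤ C := le_trans (integral_nonneg fun ω => by positivity) (hl.third 0)
  have h := norm_integral_exp_sum_sub_gaussian_le hl n (skewCoeff n k t)
  rw [sum_skewCoeff_sq n k hk] at h
  simp only [inner_normalizedSkewFourier]
  rw [show v * ‖t‖ ^ 2 / 4 = v * (‖t‖ ^ 2 / 2) / 2 by ring]
  refine h.trans ?_
  have hb := abs_skewCoeff_le n k t
  calc _ ≤ ∑ _j : Fin n, (4 * C * ((Real.sqrt n)⁻¹ * ‖t‖) ^ 3
          + v ^ 2 * ((Real.sqrt n)⁻¹ * ‖t‖) ^ 4 / 4) := by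
        refine Finset.sum_le_sum fun j _ => ?_
        gcongr <;> exact hb j
    _ = _ := by
        obtain ⟨s, hs, hs2⟩ : ∃ s : ℝ, 0 < s ∧ (n : ℝ) = s ^ 2 :=
          ⟨Real.sqrt n, Real.sqrt_pos.2 hn, (Real.sq_sqrt hn.le).symm⟩
        rw [Finset.sum_const, Finset.card_univ, Fintype.card_fin, nsmul_eq_mul, hs2,
          Real.sqrt_sq hs.le]
        field_simp

theorem measurable_normalizedSkewFourier {l : ℕ → Ω → ℝ} (hl : ∀ j, Measurable (l j)) (n : ℕ)
    (k : Fin n) : Measurable fun ω => normalizedSkewFourier n (fun j => l j ω) k := by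
  simp only [normalizedSkewFourier, skewFourier, Pi.smul_apply, smul_eq_mul]
  fun_prop

/-- The uniform error bound is averaged over `k`; the real root, which does not obey it, costs at
most 2 in the sum. -/
theorem tendsto_average_integral_exp_inner {P : Measure Ω} [IsProbabilityMeasure P]
    {l : ℕ → Ω → ℝ} {v C : ℝ} (hl : CenteredThirdMoment l P v C) (t : ℂ) :
    Tendsto (fun n : ℕ => ((n + 1 : ℕ) : ℂ)⁻¹ * ∑ k : Fin (n + 1),
        ∫ ω, exp ((inner ℝ (normalizedSkewFourier (n + 1) (fun j => l j ω) k) t : ℝ) * I) ∂P)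
      atTop (𝓝 ((Real.exp (-(v * ‖t‖ ^ 2 / 4)) : ℝ) : ℂ)) := by
  have hC : 0 ≤ C := le_trans (integral_nonneg fun ω => by positivity) (hl.third 0)
  have hv : 0 ≤ v := by
    rw [← hl.second 0]
    exact integral_nonneg fun ω => sq_nonneg _
  set g : ℂ := ((Real.exp (-(v * ‖t‖ ^ 2 / 4)) : ℝ) : ℂ) with hg
  have hg1 : ‖g‖ ≤ 1 := by
    rw [hg, norm_real, Real.norm_eq_abs, abs_of_pos (Real.exp_pos _), Real.exp_le_one_iff]
    have : 0 ≤ v * ‖t‖ ^ 2 / 4 := by positivity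
    linarith
  let δ : ℕ → ℝ := fun n => 4 * C * ‖t‖ ^ 3 * (Real.sqrt n)⁻¹ + v ^ 2 * ‖t‖ ^ 4 / 4 * (n : ℝ)⁻¹
  have hδ : Tendsto (fun n : ℕ => δ (n + 1) + 2 * ((n + 1 : ℕ) : ℝ)⁻¹) atTop (𝓝 0) := by
    have h1 : Tendsto (fun n : ℕ => (n : ℝ)⁻¹) atTop (𝓝 0) :=
      tendsto_inv_atTop_zero.comp tendsto_natCast_atTop_atTop
    have h2 : Tendsto (fun n : ℕ => (Real.sqrt n)⁻¹) atTop (𝓝 0) :=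
      tendsto_inv_atTop_zero.comp (Real.tendsto_sqrt_atTop.comp tendsto_natCast_atTop_atTop)
    have h3 := ((h2.const_mul (4 * C * ‖t‖ ^ 3)).add (h1.const_mul (v ^ 2 * ‖t‖ ^ 4 / 4))).add
      (h1.const_mul 2)
    simp only [mul_zero, add_zero] at h3
    exact (tendsto_add_atTop_iff_nat 1).2 h3
  rw [tendsto_iff_norm_sub_tendsto_zero]
  refine squeeze_zero (fun _ => norm_nonneg _) (fun n => ?_) hδ
  have hn : (0 : ℝ) < ((n + 1 : ℕ) : ℝ) := by positivity
  have hnC : ((n + 1 : ℕ) : ℂ) ≠ 0 := Nat.cast_ne_zero.2 n.succ_ne_zero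
  set a : Fin (n + 1) → ℂ := fun k =>
    ∫ ω, exp ((inner ℝ (normalizedSkewFourier (n + 1) (fun j => l j ω) k) t : ℝ) * I) ∂P
  have e : ((n + 1 : ℕ) : ℂ)⁻¹ * ∑ k, a k - g = ((n + 1 : ℕ) : ℂ)⁻¹ * ∑ k, (a k - g) := by
    rw [Finset.sum_sub_distrib, mul_sub, Finset.sum_const, Finset.card_univ, Fintype.card_fin,
      nsmul_eq_mul, inv_mul_cancel_left₀ hnC]
  have hδ0 : 0 ≤ δ (n + 1) := by positivity
  have hsum : ∑ k, ‖a k - g‖ ≤ (n + 1 : ℕ) * δ (n + 1) + 2 := by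
    calc ∑ k, ‖a k - g‖ ≤ ∑ k : Fin (n + 1), (δ (n + 1) + if k = k.rev then 2 else 0) := by
          refine Finset.sum_le_sum fun k _ => ?_
          split_ifs with hk
          · have : ‖a k‖ ≤ 1 := by
              refine (norm_integral_le_integral_norm _).trans ?_
              simp_rw [norm_exp_ofReal_mul_I]
              simp
            have := norm_sub_le (a k) g
            linarith
          · rw [add_zero]
            exact norm_integral_exp_inner_sub_le hl (n + 1) k hk t
      _ = (n + 1 : ℕ) * δ (n + 1)
          + (Finset.univ.filter fun k : Fin (n + 1) => k = k.rev).card * 2 := by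
          rw [Finset.sum_add_distrib, ← Finset.sum_filter, Finset.sum_const, Finset.sum_const,
            Finset.card_univ, Fintype.card_fin, nsmul_eq_mul, nsmul_eq_mul]
      _ ≤ (n + 1 : ℕ) * δ (n + 1) + 1 * 2 := by
          gcongr
          exact_mod_cast card_filter_eq_rev_le_one (n + 1)
      _ = _ := by ring
  rw [e, norm_mul, norm_inv, norm_natCast]
  calc _ ≤ ((n + 1 : ℕ) : ℝ)⁻¹ * ((n + 1 : ℕ) * δ (n + 1) + 2) := by
        gcongr
        exact (norm_sum_le _ _).trans hsum
    _ = _ := by field_simp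

/-- The average of the laws of finitely many complex random variables. -/
noncomputable def averageLaw (P : Measure Ω) {n : ℕ} (Z : Fin n → Ω → ℂ) : Measure ℂ :=
  (n : ENNReal)⁻¹ • ∑ k, P.map (Z k)

theorem isProbabilityMeasure_averageLaw (P : Measure Ω) [IsProbabilityMeasure P] {n : ℕ} [NeZero n]
    {Z : Fin n → Ω → ℂ} (hZ : ∀ k, Measurable (Z k)) : IsProbabilityMeasure (averageLaw P Z) := by
  have hn : (n : ENNReal) ≠ 0 := Nat.cast_ne_zero.2 (NeZero.ne n)
  refine ⟨?_⟩
  simp [averageLaw, Measure.map_apply (hZ _), ENNReal.inv_mul_cancel hn (ENNReal.natCast_ne_top n)]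

theorem integral_averageLaw {E : Type*} [NormedAddCommGroup E] [NormedSpace ℝ E]
    (P : Measure Ω) {n : ℕ} {Z : Fin n → Ω → ℂ} (hZ : ∀ k, Measurable (Z k)) {f : ℂ → E}
    (hf : Continuous f) (hint : ∀ k, Integrable (fun ω => f (Z k ω)) P) :
    ∫ z, f z ∂(averageLaw P Z) = (n : ℝ)⁻¹ • ∑ k, ∫ ω, f (Z k ω) ∂P := by
  rw [averageLaw, integral_smul_measure, integral_finsetSum_measure]
  · simp only [ENNReal.toReal_inv, ENNReal.toReal_natCast]
    congr 1
    refine Finset.sum_congr rfl fun k _ => ?_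
    exact integral_map (hZ k).aemeasurable hf.stronglyMeasurable.aestronglyMeasurable
  · intro k _
    exact (integrable_map_measure hf.stronglyMeasurable.aestronglyMeasurable (hZ k).aemeasurable).2
      (hint k)

theorem charFun_averageLaw (P : Measure Ω) [IsFiniteMeasure P] {n : ℕ} {Z : Fin n → Ω → ℂ}
    (hZ : ∀ k, Measurable (Z k)) (t : ℂ) :
    charFun (averageLaw P Z) t
      = (n : ℂ)⁻¹ * ∑ k, ∫ ω, exp ((inner ℝ (Z k ω) t : ℝ) * I) ∂P := by
  rw [charFun_apply, integral_averageLaw P hZ (by fun_prop)]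
  · rw [real_smul]
    push_cast
    rfl
  · intro k
    refine Integrable.of_bound (C := 1) ?_
      (Eventually.of_forall fun ω => (norm_exp_ofReal_mul_I _).le)
    have := hZ k
    exact Measurable.aestronglyMeasurable (by fun_prop)

end CentralLimit

/-! ### Moment bounds uniform in the size and the frequency. -/

section MomentBounds

variable {Ω : Type*} [MeasurableSpace Ω]

theorem abs_pow_le_one_add_pow (x : ℝ) {r m : ℕ} (h : r ≤ 2 * m) : |x| ^ r ≤ 1 + x ^ (2 * m) := by
  have e : x ^ (2 * m) = |x| ^ (2 * m) := by rw [pow_mul, pow_mul, sq_abs]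
  rw [e]
  rcases le_or_gt |x| 1 with hx | hx
  · have := pow_le_one₀ (abs_nonneg x) hx (n := r)
    have : 0 ≤ |x| ^ (2 * m) := by positivity
    linarith
  · have := pow_le_pow_right₀ hx.le h
    linarith

/-- Even moments of a sum of independent centred random variables, bounded in terms of the moments
of the summands. -/
theorem exists_bound_integral_sum_pow (P : Measure Ω) [IsProbabilityMeasure P] (M : ℕ → ℝ)
    (hM : ∀ q, 0 ≤ M q) (m : ℕ) :
    ∃ K : ℝ, 0 ≤ K ∧ ∀ (n : ℕ) (Y : Fin n → Ω → ℝ) (δ : ℝ), 0 ≤ δ → (∀ j, Measurable (Y j)) →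
      iIndepFun Y P → (∀ j, ∀ p : ℕ, MemLp (Y j) p P) → (∀ j, ∫ ω, Y j ω ∂P = 0) →
      (∀ j, ∀ q : ℕ, 2 ≤ q → ∫ ω, |Y j ω| ^ q ∂P ≤ M q * δ) →
      ∀ s : Finset (Fin n), s.card * δ ≤ 1 → ∫ ω, (∑ j ∈ s, Y j ω) ^ (2 * m) ∂P ≤ K := by
  induction m with
  | zero => exact ⟨1, zero_le_one, fun n Y δ _ _ _ _ _ _ s _ => by simp⟩
  | succ m ih =>
    obtain ⟨K, hK, ihK⟩ := ih
    -- Total of the binomial terms in which the new summand has exponent at least 2; adding one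
    -- summand raises the moment of order 2m+2 by at most D δ.
    set D : ℝ := ∑ r ∈ Finset.range (2 * m + 1),
      ((1 + K) * M (2 * m + 2 - r)) * ((2 * m + 2).choose r : ℝ) with hD
    have hD0 : 0 ≤ D := Finset.sum_nonneg fun r _ => by
      have := hM (2 * m + 2 - r)
      positivity
    refine ⟨D, hD0, fun n Y δ hδ hYm hYi hYp hY0 hYq s hs => ?_⟩
    -- A bound linear in the number of summands is what the induction over `s` can carry.
    suffices H : ∀ s : Finset (Fin n), s.card * δ ≤ 1 →
        ∫ ω, (∑ j ∈ s, Y j ω) ^ (2 * (m + 1)) ∂P ≤ D * (s.card * δ) from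
      (H s hs).trans (mul_le_of_le_one_right hD0 hs)
    intro s
    induction s using Finset.induction_on with
    | empty => intro _; simp
    | insert i s hi ihs =>
      intro hcard
      rw [Finset.card_insert_of_notMem hi] at hcard ⊢
      push_cast at hcard ⊢
      have hs1 : (s.card : ℝ) * δ ≤ 1 := by linarith
      set S : Ω → ℝ := fun ω => ∑ j ∈ s, Y j ω with hS
      have hSp : ∀ p : ℕ, MemLp S p P := fun p => memLp_finsetSum s fun j _ => hYp j p
      have hind : IndepFun S (Y i) P := by
        have := hYi.indepFun_finsetSum_of_notMem hYm hi
        convert this using 1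
        ext ω
        simp [hS]
      have hpow : ∀ r q : ℕ, IndepFun (fun ω => S ω ^ r) (fun ω => Y i ω ^ q) P := fun r q =>
        hind.comp (φ := fun x => x ^ r) (ψ := fun x => x ^ q) (by fun_prop) (by fun_prop)
      have hSr : ∀ r : ℕ, Integrable (fun ω => S ω ^ r) P := fun r => by
        refine (hSp r).integrable_norm_pow'.mono' ?_ (Eventually.of_forall fun ω => ?_)
        · have := (hSp r).aestronglyMeasurable
          exact this.pow r
        · simp
      have hYr : ∀ r : ℕ, Integrable (fun ω => Y i ω ^ r) P := fun r => by
        refine (hYp i r).integrable_norm_pow'.mono' ?_ (Eventually.of_forall fun ω => ?_)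
        · have := (hYp i r).aestronglyMeasurable
          exact this.pow r
        · simp
      have hexp : ∫ ω, (∑ j ∈ insert i s, Y j ω) ^ (2 * (m + 1)) ∂P
          = ∑ r ∈ Finset.range (2 * m + 2 + 1), (∫ ω, S ω ^ r ∂P)
            * (∫ ω, Y i ω ^ (2 * m + 2 - r) ∂P) * ((2 * m + 2).choose r : ℝ) := by
        have e : ∀ ω, (∑ j ∈ insert i s, Y j ω) ^ (2 * (m + 1))
            = ∑ r ∈ Finset.range (2 * m + 2 + 1), S ω ^ r * Y i ω ^ (2 * m + 2 - r)
              * ((2 * m + 2).choose r : ℝ) := fun ω => by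
          rw [Finset.sum_insert hi, add_comm, ← add_pow]
          rfl
        have hmul : ∀ r, Integrable (fun ω => S ω ^ r * Y i ω ^ (2 * m + 2 - r)) P := fun r =>
          (hpow r _).integrable_mul (hSr r) (hYr _)
        simp_rw [e]
        rw [integral_finsetSum _ fun r _ => (hmul r).mul_const _]
        refine Finset.sum_congr rfl fun r _ => ?_
        rw [integral_mul_const, (hpow r _).integral_fun_mul_eq_mul_integral
          (hSr r).aestronglyMeasurable (hYr _).aestronglyMeasurable]
      -- The term r = 2m+2 is the moment of the old sum, and r = 2m+1 vanishes by centring. The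
      -- other terms involve only moments of the old sum of order at most 2m.
      rw [hexp, Finset.sum_range_succ, Finset.sum_range_succ]
      have hlast : 2 * m + 2 - (2 * m + 1) = 1 := by omega
      simp only [hlast, pow_one, hY0 i, mul_zero, zero_mul, add_zero, Nat.sub_self, pow_zero,
        integral_const, probReal_univ, smul_eq_mul, mul_one, Nat.choose_self, Nat.cast_one]
      have hSK : ∀ r, r ≤ 2 * m → |∫ ω, S ω ^ r ∂P| ≤ 1 + K := by
        intro r hr
        refine (abs_integral_le_integral_abs).trans ?_
        calc ∫ ω, |S ω ^ r| ∂P ≤ ∫ ω, (1 + S ω ^ (2 * m)) ∂P :=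
              integral_mono (hSr r).abs ((integrable_const _).add (hSr _)) fun ω => by
                rw [abs_pow]
                exact abs_pow_le_one_add_pow _ hr
          _ = 1 + ∫ ω, S ω ^ (2 * m) ∂P := by
              rw [integral_add (integrable_const _) (hSr _)]
              simp
          _ ≤ 1 + K := by
              gcongr
              exact ihK n Y δ hδ hYm hYi hYp hY0 hYq s hs1
      have hmain : ∑ r ∈ Finset.range (2 * m + 1), (∫ ω, S ω ^ r ∂P)
            * (∫ ω, Y i ω ^ (2 * m + 2 - r) ∂P) * ((2 * m + 2).choose r : ℝ) ≤ D * δ := by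
        rw [hD, Finset.sum_mul]
        refine Finset.sum_le_sum fun r hr => ?_
        have hr' : r ≤ 2 * m := by
          have := Finset.mem_range.1 hr
          omega
        have h1 : |∫ ω, Y i ω ^ (2 * m + 2 - r) ∂P| ≤ M (2 * m + 2 - r) * δ := by
          refine (abs_integral_le_integral_abs).trans ?_
          simp_rw [abs_pow]
          exact hYq i _ (by omega)
        calc _ ≤ ((1 + K) * (M (2 * m + 2 - r) * δ)) * ((2 * m + 2).choose r : ℝ) := by
              refine mul_le_mul_of_nonneg_right ((le_abs_self _).trans ?_) (Nat.cast_nonneg _)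
              rw [abs_mul]
              exact mul_le_mul (hSK r hr') h1 (abs_nonneg _) (by linarith)
          _ = _ := by ring
      have h2 := ihs hs1
      have e2 : ∫ ω, S ω ^ (2 * m + 2) ∂P ≤ D * (s.card * δ) := h2
      linarith

/-- Real and imaginary parts are the linear forms for t = 1 and t = i, with coefficients at most
n^{-1/2} ≤ 1. Their q-th powers are thus at most 1/n for q ≥ 2, and `exists_bound_integral_sum_pow`
applies with δ = 1/n. The real root is included, as odd moments require. -/
theorem exists_bound_integral_norm_normalizedSkewFourier_pow {P : Measure Ω}
    [IsProbabilityMeasure P] {l : ℕ → Ω → ℝ} (hl : IndepStandardBddMoments l P) (m : ℕ) :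
    ∃ K : ℝ, ∀ (n : ℕ) (k : Fin n),
      Integrable (fun ω => ‖normalizedSkewFourier n (fun j => l j ω) k‖ ^ (2 * m)) P ∧
      ∫ ω, ‖normalizedSkewFourier n (fun j => l j ω) k‖ ^ (2 * m) ∂P ≤ K := by
  choose C hC using hl.bdd
  have hC0 : ∀ q, 0 ≤ C q := fun q => le_trans (integral_nonneg fun ω => by positivity) (hC q 0)
  obtain ⟨K, hK0, hK⟩ := exists_bound_integral_sum_pow P C hC0 m
  have key : ∀ (n : ℕ) (k : Fin n) (t : ℂ), ‖t‖ = 1 →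
      Integrable (fun ω => (inner ℝ (normalizedSkewFourier n (fun j => l j ω) k) t : ℝ) ^ (2 * m)) P
      ∧ ∫ ω, (inner ℝ (normalizedSkewFourier n (fun j => l j ω) k) t : ℝ) ^ (2 * m) ∂P ≤ K := by
    intro n k t ht
    have hn : (0 : ℝ) < n := Nat.cast_pos.2 (Fin.pos k)
    have hn1 : (1 : ℝ) ≤ n := Nat.one_le_cast.2 (Fin.pos k)
    have hp : ∀ (j : Fin n) (p : ℕ), MemLp (fun ω => l j ω * skewCoeff n k t j) p P := fun j p =>
      (hl.memLp j p).mul_const _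
    simp only [inner_normalizedSkewFourier]
    constructor
    · have hS : MemLp (fun ω => ∑ j : Fin n, l j ω * skewCoeff n k t j) (2 * m : ℕ) P :=
        memLp_finsetSum _ fun j _ => hp j _
      refine hS.integrable_norm_pow'.congr (Eventually.of_forall fun ω => ?_)
      simp [pow_mul]
    · refine hK n (fun j ω => l j ω * skewCoeff n k t j) (n : ℝ)⁻¹ (by positivity)
        (fun j => (hl.measurable j).mul_const _) ?_ hp ?_ ?_ Finset.univ ?_
      · exact (hl.indep.precomp Fin.val_injective).comp (fun j x => x * skewCoeff n k t j)
          fun j => by fun_prop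
      · intro j
        rw [integral_mul_const, hl.mean, zero_mul]
      · intro j q hq
        simp_rw [abs_mul, mul_pow]
        rw [integral_mul_const]
        have hb := abs_skewCoeff_le n k t j
        rw [ht, mul_one] at hb
        have hs1 : (Real.sqrt n)⁻¹ ≤ 1 := inv_le_one_of_one_le₀ (Real.one_le_sqrt.2 hn1)
        have h1 : |skewCoeff n k t j| ^ q ≤ (n : ℝ)⁻¹ := by
          calc |skewCoeff n k t j| ^ q ≤ |skewCoeff n k t j| ^ 2 :=
                pow_le_pow_of_le_one (abs_nonneg _) (hb.trans hs1) hq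
            _ ≤ (Real.sqrt n)⁻¹ ^ 2 := by gcongr
            _ = (n : ℝ)⁻¹ := by rw [inv_pow, Real.sq_sqrt hn.le]
        exact mul_le_mul (hC q j) h1 (by positivity) (hC0 q)
      · simp [hn.ne']
  -- Convexity: (a + b)^m ≤ 2^(m-1) (a^m + b^m) for a, b ≥ 0; the truncated subtraction keeps this
  -- true at m = 0.
  refine ⟨2 ^ (m - 1) * (K + K), fun n k => ?_⟩
  obtain ⟨hi1, hb1⟩ := key n k 1 (by simp)
  obtain ⟨hi2, hb2⟩ := key n k Complex.I (by simp)
  have hle : ∀ ω, ‖normalizedSkewFourier n (fun j => l j ω) k‖ ^ (2 * m)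
      ≤ 2 ^ (m - 1) * ((inner ℝ (normalizedSkewFourier n (fun j => l j ω) k) 1 : ℝ) ^ (2 * m)
        + (inner ℝ (normalizedSkewFourier n (fun j => l j ω) k) Complex.I : ℝ) ^ (2 * m)) := by
    intro ω
    set z := normalizedSkewFourier n (fun j => l j ω) k
    have e1 : (inner ℝ z 1 : ℝ) = z.re := by simp [Complex.inner]
    have e2 : (inner ℝ z Complex.I : ℝ) = z.im := by simp [Complex.inner]
    rw [e1, e2, pow_mul, pow_mul, pow_mul, ← Complex.normSq_eq_norm_sq, Complex.normSq_apply,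
      ← sq, ← sq]
    exact add_pow_le (sq_nonneg _) (sq_nonneg _) m
  have hint : Integrable (fun ω => ‖normalizedSkewFourier n (fun j => l j ω) k‖ ^ (2 * m)) P := by
    refine ((hi1.add hi2).const_mul (2 ^ (m - 1))).mono' ?_ (Eventually.of_forall fun ω => ?_)
    · have := measurable_normalizedSkewFourier hl.measurable n k
      exact Measurable.aestronglyMeasurable (by fun_prop)
    · rw [Real.norm_of_nonneg (by positivity)]
      exact hle ω
  refine ⟨hint, (integral_mono hint ((hi1.add hi2).const_mul _) hle).trans ?_⟩
  rw [integral_const_mul, integral_add' hi1 hi2]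
  gcongr

end MomentBounds

/-! ### From weak convergence to convergence of even moments. -/

section MomentConvergence

/-- Uniform integrability from a second moment: replacing g by min g R costs at most g²/R, hence K/R
in the mean. With g = ‖z‖^(2m) the required hypothesis is a bound on moments of order 4m. -/
theorem tendsto_integral_of_tendsto_of_bounded_sq {X : Type*} [MeasurableSpace X]
    [TopologicalSpace X] [BorelSpace X] {μ : ℕ → ProbabilityMeasure X}
    {ν : ProbabilityMeasure X} (h : Tendsto μ atTop (𝓝 ν)) {g : X → ℝ} (hg : Continuous g)
    (hg0 : ∀ x, 0 ≤ g x) {K : ℝ} (hμ : ∀ n, Integrable (fun x => g x ^ 2) (μ n : Measure X))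
    (hμK : ∀ n, ∫ x, g x ^ 2 ∂(μ n : Measure X) ≤ K)
    (hν : Integrable (fun x => g x ^ 2) (ν : Measure X)) (hνK : ∫ x, g x ^ 2 ∂(ν : Measure X) ≤ K) :
    Tendsto (fun n => ∫ x, g x ∂(μ n : Measure X)) atTop (𝓝 (∫ x, g x ∂(ν : Measure X))) := by
  have hK : 0 ≤ K := (integral_nonneg fun x => sq_nonneg _).trans hνK
  have trunc : ∀ (ρ : ProbabilityMeasure X), Integrable (fun x => g x ^ 2) (ρ : Measure X) →
      ∫ x, g x ^ 2 ∂(ρ : Measure X) ≤ K → ∀ R : ℝ, 0 < R →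
      |∫ x, g x ∂(ρ : Measure X) - ∫ x, min (g x) R ∂(ρ : Measure X)| ≤ K / R := by
    intro ρ hi hb R hR
    have hgm : AEStronglyMeasurable g (ρ : Measure X) := hg.aestronglyMeasurable
    have hgi : Integrable g (ρ : Measure X) := by
      refine ((integrable_const (1 : ℝ)).add hi).mono' hgm (Eventually.of_forall fun x => ?_)
      simp only [Real.norm_eq_abs, abs_of_nonneg (hg0 x), Pi.add_apply]
      nlinarith [sq_nonneg (g x - 1), hg0 x]
    have hmi : Integrable (fun x => min (g x) R) (ρ : Measure X) := hgi.inf (integrable_const R)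
    rw [← integral_sub hgi hmi]
    have hnn : ∀ x, 0 ≤ g x - min (g x) R := fun x => sub_nonneg.2 (min_le_left _ _)
    rw [abs_of_nonneg (integral_nonneg hnn)]
    calc ∫ x, (g x - min (g x) R) ∂(ρ : Measure X) ≤ ∫ x, g x ^ 2 / R ∂(ρ : Measure X) := by
          refine integral_mono (hgi.sub hmi) (hi.div_const R) fun x => ?_
          beta_reduce
          rcases le_total (g x) R with hx | hx
          · rw [min_eq_left hx, sub_self]
            positivity
          · rw [min_eq_right hx, le_div_iff₀ hR]
            nlinarith [hg0 x]
      _ ≤ K / R := by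
          rw [integral_div]
          gcongr
  rw [Metric.tendsto_atTop]
  intro ε hε
  -- Makes each truncation error at most ε/4; the 1 keeps `R` positive when `K` is 0.
  set R : ℝ := 4 * K / ε + 1 with hR
  have hR0 : 0 < R := by positivity
  have hKR : K / R ≤ ε / 4 := by
    rw [div_le_iff₀ hR0, hR]
    have : ε / 4 * (4 * K / ε + 1) = K + ε / 4 := by field_simp
    linarith
  have hbcf := (ProbabilityMeasure.tendsto_iff_forall_integral_tendsto.1 h)
    (BoundedContinuousFunction.ofNormedAddCommGroup (fun x => min (g x) R)
      (hg.min continuous_const) R fun x => by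
        rw [Real.norm_of_nonneg (le_min (hg0 x) hR0.le)]
        exact min_le_right _ _)
  obtain ⟨N, hN⟩ := Metric.tendsto_atTop.1 hbcf (ε / 2) (by positivity)
  refine ⟨N, fun n hn => ?_⟩
  have h1 := hN n hn
  simp only [BoundedContinuousFunction.coe_ofNormedAddCommGroup, Real.dist_eq] at h1
  have h2 := trunc (μ n) (hμ n) (hμK n) R hR0
  have h3 := trunc ν hν hνK R hR0
  rw [Real.dist_eq]
  rw [abs_le] at h2 h3
  rw [abs_lt] at h1 ⊢
  constructor <;> linarith

variable {Ω : Type*} [MeasurableSpace Ω]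

theorem IndepStandardBddMoments.exists_centeredThirdMoment {P : Measure Ω} [IsProbabilityMeasure P]
    {l : ℕ → Ω → ℝ} (hl : IndepStandardBddMoments l P) : ∃ C, CenteredThirdMoment l P 1 C := by
  obtain ⟨C, hC⟩ := hl.bdd 3
  refine ⟨C, hl.measurable, hl.indep, fun j => by exact_mod_cast hl.memLp j 3, hl.mean,
    fun j => ?_, hC⟩
  have h := hl.variance j
  rw [variance_of_integral_eq_zero (hl.measurable j).aemeasurable (hl.mean j)] at h
  exact h

/-- The averaged law of the normalized Fourier transform at the `n + 1` roots of `-1`. -/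
noncomputable def averageSkewFourierLaw {P : Measure Ω} [IsProbabilityMeasure P] {l : ℕ → Ω → ℝ}
    (hl : ∀ j, Measurable (l j)) (n : ℕ) : ProbabilityMeasure ℂ :=
  ⟨averageLaw P fun k ω => normalizedSkewFourier (n + 1) (fun j => l j ω) k,
    isProbabilityMeasure_averageLaw P fun k => measurable_normalizedSkewFourier hl (n + 1) k⟩

theorem tendsto_averageSkewFourierLaw {P : Measure Ω} [IsProbabilityMeasure P] {l : ℕ → Ω → ℝ}
    {C : ℝ} (hl : CenteredThirdMoment l P 1 C) :
    Tendsto (averageSkewFourierLaw (P := P) hl.measurable) atTop (𝓝 complexGaussian) := by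
  refine ProbabilityMeasure.tendsto_of_tendsto_charFun fun t => ?_
  rw [charFun_complexGaussian]
  have h := tendsto_average_integral_exp_inner hl t
  convert h using 1
  · ext n
    exact charFun_averageLaw P (fun k => measurable_normalizedSkewFourier hl.measurable (n + 1) k) t
  · congr 1
    push_cast
    ring_nf

theorem tendsto_average_integral_norm_pow {P : Measure Ω} [IsProbabilityMeasure P] {l : ℕ → Ω → ℝ}
    (hl : IndepStandardBddMoments l P) (m : ℕ) :
    Tendsto (fun n : ℕ => ((n + 1 : ℕ) : ℝ)⁻¹ * ∑ k : Fin (n + 1),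
        ∫ ω, ‖normalizedSkewFourier (n + 1) (fun j => l j ω) k‖ ^ (2 * m) ∂P)
      atTop (𝓝 (m.factorial : ℝ)) := by
  obtain ⟨C, hC⟩ := hl.exists_centeredThirdMoment
  have hmeas := fun n k => measurable_normalizedSkewFourier hl.measurable (n + 1) k
  obtain ⟨K₁, hK₁⟩ := exists_bound_integral_norm_normalizedSkewFourier_pow hl m
  obtain ⟨K₂, hK₂⟩ := exists_bound_integral_norm_normalizedSkewFourier_pow hl (2 * m)
  have hsq : ∀ z : ℂ, (‖z‖ ^ (2 * m)) ^ 2 = ‖z‖ ^ (2 * (2 * m)) := fun z => by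
    rw [← pow_mul]; congr 1; ring
  have hint : ∀ n, Integrable (fun z : ℂ => ‖z‖ ^ (2 * (2 * m)))
      (averageLaw P fun (k : Fin (n + 1)) ω =>
        normalizedSkewFourier (n + 1) (fun j => l j ω) k) := by
    intro n
    refine Integrable.smul_measure ?_ (by simp)
    rw [integrable_finsetSum_measure]
    intro k _
    rw [integrable_map_measure (by fun_prop) (hmeas n k).aemeasurable]
    exact (hK₂ (n + 1) k).1
  have key := tendsto_integral_of_tendsto_of_bounded_sq (tendsto_averageSkewFourierLaw hC)
    (g := fun z => ‖z‖ ^ (2 * m)) (by fun_prop) (fun z => by positivity)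
    (K := max K₂ ((2 * m).factorial : ℝ))
    (fun n => by simp_rw [hsq]; exact hint n)
    (fun n => by
      simp_rw [hsq]
      refine (integral_averageLaw P (hmeas n) (by fun_prop)
        fun k => (hK₂ (n + 1) k).1).trans_le ((?_ : _ ≤ K₂).trans (le_max_left _ _))
      rw [smul_eq_mul, inv_mul_le_iff₀ (by positivity)]
      refine (Finset.sum_le_sum fun k _ => (hK₂ (n + 1) k).2).trans_eq ?_
      simp)
    (by simp_rw [hsq]; exact integrable_norm_pow_complexGaussian _)
    (by
      simp_rw [hsq]
      rw [integral_norm_pow_complexGaussian]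
      exact le_max_right _ _)
  rw [integral_norm_pow_complexGaussian] at key
  refine key.congr fun n => ?_
  exact integral_averageLaw P (hmeas n) (by fun_prop) fun k => (hK₁ (n + 1) k).1

end MomentConvergence

/-! ### Convergence in *-distribution. -/

section StarMoments

theorem StarMonomial.eval_of_isSelfAdjoint {A : Type*} [Ring A] [StarRing A] (Q : StarMonomial)
    {a : A} (ha : IsSelfAdjoint a) : Q.eval a = a ^ Q.length := by
  have h : (Q.map fun b => if b then star a else a) = List.replicate Q.length a := by
    induction Q with
    | nil => rfl
    | cons b Q ih =>
      rw [List.map_cons, ih, List.length_cons, List.replicate_succ]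
      simp [ha.star_eq]
  rw [StarMonomial.eval, h, List.prod_replicate]

variable {Ω : Type*} [MeasurableSpace Ω]

theorem randomMatrixState_pow (P : Measure Ω) [IsProbabilityMeasure P] (n : ℕ) [NeZero n]
    (M : randomMatrixAlgebra P n) (p : ℕ) :
    (randomMatrixState P n).toLin (M ^ p) = (n : ℂ)⁻¹ * ∫ ω, (M.1 ω ^ p).trace ∂P :=
  rfl

theorem isSelfAdjoint_leftSkewCirculantVariable {l : ℕ → Ω → ℝ} {P : Measure Ω}
    [IsProbabilityMeasure P] (hl : IndepStandardBddMoments l P) (n : ℕ) :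
    IsSelfAdjoint (leftSkewCirculantVariable hl n) := by
  apply Subtype.ext
  funext ω
  change ((normalizedLeftSkewCirculant n fun k => l k ω).map Complex.ofReal).conjTranspose = _
  ext i j
  have := (normalizedLeftSkewCirculant_isHermitian n fun k => l k ω).apply i j
  simp only [Matrix.conjTranspose_apply, Matrix.map_apply, Complex.star_def, Complex.conj_ofReal]
  exact congrArg Complex.ofReal this

theorem randomMatrixState_leftSkewCirculant_pow_even {l : ℕ → Ω → ℝ} {P : Measure Ω}
    [IsProbabilityMeasure P] (hl : IndepStandardBddMoments l P) (n : ℕ) [NeZero n] (m : ℕ) :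
    (randomMatrixState P n).toLin (leftSkewCirculantVariable hl n ^ (2 * m))
      = (((n : ℝ)⁻¹ * ∑ k : Fin n,
        ∫ ω, ‖normalizedSkewFourier n (fun j => l j ω) k‖ ^ (2 * m) ∂P : ℝ) : ℂ) := by
  obtain ⟨K, hK⟩ := exists_bound_integral_norm_normalizedSkewFourier_pow hl m
  rw [randomMatrixState_pow, ← integral_finsetSum _ fun k _ => (hK n k).1, Complex.ofReal_mul,
    ← integral_complex_ofReal]
  push_cast
  congr 1
  refine integral_congr_ae (Eventually.of_forall fun ω => ?_)
  change (((normalizedLeftSkewCirculant n fun k => l k ω).map Complex.ofReal) ^ (2 * m)).trace = _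
  rw [normalizedLeftSkewCirculant_eq, trace_leftSkewCirculant_pow_even]
  push_cast
  rfl

/-- At most one frequency contributes to the trace, and its absolute moment of order 2m+1 is
dominated by 1 plus the even moment of order 2m+2, which is bounded. Division by the size sends it
to zero. -/
theorem tendsto_randomMatrixState_leftSkewCirculant_pow_odd {l : ℕ → Ω → ℝ} {P : Measure Ω}
    [IsProbabilityMeasure P] (hl : IndepStandardBddMoments l P) (m : ℕ) :
    Tendsto (fun n : ℕ => (randomMatrixState P (n + 1)).toLin
      (leftSkewCirculantVariable hl (n + 1) ^ (2 * m + 1))) atTop (𝓝 0) := by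
  obtain ⟨K, hK⟩ := exists_bound_integral_norm_normalizedSkewFourier_pow hl (m + 1)
  have hlim : Tendsto (fun n : ℕ => ((n + 1 : ℕ) : ℝ)⁻¹ * (1 + K)) atTop (𝓝 0) := by
    have h1 : Tendsto (fun n : ℕ => (n : ℝ)⁻¹) atTop (𝓝 0) :=
      tendsto_inv_atTop_zero.comp tendsto_natCast_atTop_atTop
    simpa using ((tendsto_add_atTop_iff_nat 1).2 h1).mul_const (1 + K)
  refine squeeze_zero_norm (fun n => ?_) hlim
  rw [randomMatrixState_pow, norm_mul, norm_inv, Complex.norm_natCast]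
  gcongr
  set Λ : Fin (n + 1) → Ω → ℂ := fun k ω => normalizedSkewFourier (n + 1) (fun j => l j ω) k
  have htr : ∀ ω, ‖((leftSkewCirculantVariable hl (n + 1)).1 ω ^ (2 * m + 1)).trace‖
      ≤ ∑ k, if k = k.rev then 1 + ‖Λ k ω‖ ^ (2 * (m + 1)) else 0 := by
    intro ω
    change ‖(((normalizedLeftSkewCirculant (n + 1) fun k => l k ω).map Complex.ofReal)
      ^ (2 * m + 1)).trace‖ ≤ _
    rw [normalizedLeftSkewCirculant_eq, trace_leftSkewCirculant_pow_odd]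
    refine (norm_sum_le _ _).trans (Finset.sum_le_sum fun k _ => ?_)
    split_ifs
    · rw [Complex.norm_real, Real.norm_eq_abs, abs_pow]
      calc _ ≤ |‖Λ k ω‖| ^ (2 * m + 1) := by
            rw [abs_norm]
            gcongr
            exact Complex.abs_re_le_norm _
        _ ≤ _ := abs_pow_le_one_add_pow _ (by omega)
    · simp
  have hi : ∀ k, Integrable (fun ω => 1 + ‖Λ k ω‖ ^ (2 * (m + 1))) P := fun k =>
    (integrable_const _).add (hK (n + 1) k).1
  have hK0 : 0 ≤ K := le_trans (integral_nonneg fun ω => by positivity) (hK (n + 1) 0).2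
  calc ‖∫ ω, ((leftSkewCirculantVariable hl (n + 1)).1 ω ^ (2 * m + 1)).trace ∂P‖
      ≤ ∫ ω, ∑ k, (if k = k.rev then 1 + ‖Λ k ω‖ ^ (2 * (m + 1)) else 0) ∂P := by
        refine norm_integral_le_of_norm_le (integrable_finsetSum _ fun k _ => ?_)
          (Eventually.of_forall htr)
        split_ifs
        · exact hi k
        · exact integrable_zero _ _ _
    _ = ∑ k, if k = k.rev then ∫ ω, (1 + ‖Λ k ω‖ ^ (2 * (m + 1))) ∂P else 0 := by
        rw [integral_finsetSum]
        · refine Finset.sum_congr rfl fun k _ => ?_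
          split_ifs <;> simp
        · intro k _
          split_ifs
          · exact hi k
          · exact integrable_zero _ _ _
    _ ≤ ∑ k : Fin (n + 1), if k = k.rev then 1 + K else 0 := by
        refine Finset.sum_le_sum fun k _ => ?_
        split_ifs
        · rw [integral_add (integrable_const _) (hK (n + 1) k).1]
          have := (hK (n + 1) k).2
          simpa using this
        · exact le_rfl
    _ = (Finset.univ.filter fun k : Fin (n + 1) => k = k.rev).card * (1 + K) := by
        rw [← Finset.sum_filter, Finset.sum_const, nsmul_eq_mul]
    _ ≤ 1 * (1 + K) := by
        gcongr
        exact_mod_cast card_filter_eq_rev_le_one (n + 1)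
    _ = 1 + K := one_mul _

/-- A self-adjoint variable with the symmetrized Rayleigh distribution: the coordinate function on
the real line, seen as a random `1 × 1` matrix. -/
def rayleighVariable : randomMatrixAlgebra (symmetrizedRayleigh : Measure ℝ) 1 :=
  ⟨fun x => Matrix.diagonal fun _ => (x : ℂ), by
    intro i j p
    have : (fun x : ℝ => (Matrix.diagonal fun _ : Fin 1 => (x : ℂ)) i j)
        = fun x : ℝ => (x : ℂ) := by
      funext x
      rw [Subsingleton.elim i j, Matrix.diagonal_apply_eq]
    rw [this]
    exact (memLp_id_symmetrizedRayleigh p).ofReal⟩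

theorem isSelfAdjoint_rayleighVariable : IsSelfAdjoint rayleighVariable := by
  apply Subtype.ext
  funext x
  change (Matrix.diagonal fun _ : Fin 1 => (x : ℂ)).conjTranspose = Matrix.diagonal fun _ => (x : ℂ)
  rw [Matrix.diagonal_conjTranspose]
  congr 1
  funext i
  simp

theorem randomMatrixState_rayleighVariable_pow (p : ℕ) :
    (randomMatrixState (symmetrizedRayleigh : Measure ℝ) 1).toLin (rayleighVariable ^ p)
      = ((∫ x, x ^ p ∂(symmetrizedRayleigh : Measure ℝ) : ℝ) : ℂ) := by
  rw [randomMatrixState_pow, ← integral_complex_ofReal]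
  simp only [Nat.cast_one, inv_one, one_mul]
  refine integral_congr_ae (Eventually.of_forall fun x => ?_)
  change ((Matrix.diagonal fun _ : Fin 1 => (x : ℂ)) ^ p).trace = _
  rw [Matrix.diagonal_pow, Matrix.trace_diagonal]
  simp

theorem convergesInStarDistribution_leftSkewCirculant {P : Measure Ω} [IsProbabilityMeasure P]
    {l : ℕ → Ω → ℝ} (hl : IndepStandardBddMoments l P) :
    ConvergesInStarDistribution (fun n => randomMatrixState P (n + 1))
      (fun n => leftSkewCirculantVariable hl (n + 1))
      (randomMatrixState (symmetrizedRayleigh : Measure ℝ) 1) rayleighVariable := by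
  intro Q
  have h1 : ∀ n, Q.eval (leftSkewCirculantVariable hl n)
      = leftSkewCirculantVariable hl n ^ Q.length := fun n =>
    Q.eval_of_isSelfAdjoint (a := leftSkewCirculantVariable hl n)
      (isSelfAdjoint_leftSkewCirculantVariable hl n)
  have h2 : Q.eval rayleighVariable = rayleighVariable ^ Q.length :=
    Q.eval_of_isSelfAdjoint (a := rayleighVariable) isSelfAdjoint_rayleighVariable
  simp only [h1, h2, randomMatrixState_rayleighVariable_pow]
  obtain ⟨m, h | h⟩ := Q.length.even_or_odd' <;> rw [h]
  · simp only [randomMatrixState_leftSkewCirculant_pow_even, integral_pow_even_symmetrizedRayleigh]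
    exact (Complex.continuous_ofReal.tendsto _).comp (tendsto_average_integral_norm_pow hl m)
  · rw [integral_pow_odd_symmetrizedRayleigh, Complex.ofReal_zero]
    exact tendsto_randomMatrixState_leftSkewCirculant_pow_odd hl m

end StarMoments

/-! ### The Efron–Stein inequality and a fourth moment bound. -/

section EfronStein

variable {X : Type*} [MeasurableSpace X]

theorem integrable_of_measurable_of_abs_le {Y : Type*} [MeasurableSpace Y] {ν : Measure Y}
    [IsFiniteMeasure ν] {f : Y → ℝ} (hf : Measurable f) {C : ℝ} (hC : ∀ y, |f y| ≤ C) :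
    Integrable f ν :=
  Integrable.of_bound (C := C) hf.aestronglyMeasurable (Eventually.of_forall hC)

theorem abs_integral_le_of_abs_le {Y : Type*} [MeasurableSpace Y] (ν : Measure Y)
    [IsProbabilityMeasure ν] {f : Y → ℝ} {C : ℝ} (hC : ∀ y, |f y| ≤ C) : |∫ y, f y ∂ν| ≤ C := by
  have h := norm_integral_le_of_norm_le_const (μ := ν) (f := f) (C := C) (Eventually.of_forall hC)
  simpa using h

theorem integral_sub_const_sq {Y : Type*} [MeasurableSpace Y] (ν : Measure Y)
    [IsProbabilityMeasure ν] {f : Y → ℝ} (h1 : Integrable f ν)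
    (h2 : Integrable (fun y => f y ^ 2) ν) (c : ℝ) :
    ∫ y, (f y - c) ^ 2 ∂ν = ∫ y, f y ^ 2 ∂ν - 2 * c * ∫ y, f y ∂ν + c ^ 2 := by
  have h3 : Integrable (fun y => f y ^ 2 - 2 * c * f y) ν := h2.sub (h1.const_mul _)
  have : ∀ y, (f y - c) ^ 2 = f y ^ 2 - 2 * c * f y + c ^ 2 := fun y => by ring
  simp_rw [this]
  rw [integral_add h3 (integrable_const _), integral_sub h2 (h1.const_mul _), integral_const_mul]
  simp

/-- The mean minimizes the quadratic deviation, so an arbitrary constant, in particular a value at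
the reference point, may replace it. -/
theorem integral_sq_sub_sq_integral_le {Y : Type*} [MeasurableSpace Y] (ν : Measure Y)
    [IsProbabilityMeasure ν] {f : Y → ℝ} (hf : Measurable f) {C : ℝ} (hC : ∀ y, |f y| ≤ C) (c : ℝ) :
    ∫ y, f y ^ 2 ∂ν - (∫ y, f y ∂ν) ^ 2 ≤ ∫ y, (f y - c) ^ 2 ∂ν := by
  have h1 : Integrable f ν := integrable_of_measurable_of_abs_le hf hC
  have h2 : Integrable (fun y => f y ^ 2) ν :=
    integrable_of_measurable_of_abs_le (C := C ^ 2) (by fun_prop) fun y => by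
      rw [abs_pow]
      exact pow_le_pow_left₀ (abs_nonneg _) (hC y) 2
  rw [integral_sub_const_sq ν h1 h2]
  nlinarith [sq_nonneg (∫ y, f y ∂ν - c)]

theorem piFinSuccAbove_zero_symm_apply (n : ℕ) (z : X × (Fin n → X)) :
    (MeasurableEquiv.piFinSuccAbove (fun _ : Fin (n + 1) => X) 0).symm z = Fin.cons z.1 z.2 :=
  Fin.insertNth_zero' z.1 z.2

theorem measurable_finCons (n : ℕ) :
    Measurable fun z : X × (Fin n → X) => (Fin.cons z.1 z.2 : Fin (n + 1) → X) := by
  simp_rw [← piFinSuccAbove_zero_symm_apply]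
  exact MeasurableEquiv.measurable _

theorem integral_pi_succ (μ : Measure X) [IsProbabilityMeasure μ] (n : ℕ)
    {F : (Fin (n + 1) → X) → ℝ} (hF : Measurable F) {C : ℝ} (hC : ∀ x, |F x| ≤ C) :
    ∫ x, F x ∂(Measure.pi fun _ : Fin (n + 1) => μ)
      = ∫ x₀, ∫ y, F (Fin.cons x₀ y) ∂(Measure.pi fun _ : Fin n => μ) ∂μ := by
  have h := ((measurePreserving_piFinSuccAbove (fun _ : Fin (n + 1) => μ) 0).symm).integral_comp' F
  simp only [piFinSuccAbove_zero_symm_apply] at h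
  rw [← h, integral_prod]
  · exact integrable_of_measurable_of_abs_le
      (hF.comp (measurable_finCons n)) fun z => hC _

theorem measurable_integral_finCons (μ : Measure X) [IsProbabilityMeasure μ] (n : ℕ)
    {F : (Fin (n + 1) → X) → ℝ} (hF : Measurable F) :
    Measurable fun x₀ => ∫ y, F (Fin.cons x₀ y) ∂(Measure.pi fun _ : Fin n => μ) := by
  have h : StronglyMeasurable fun z : X × (Fin n → X) => F (Fin.cons z.1 z.2) :=
    (hF.comp (measurable_finCons n)).stronglyMeasurable
  exact h.integral_prod_right.measurable

/-- The **Efron–Stein inequality** on a product space, where resampling of a coordinate is replaced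
by setting it to a reference point. -/
theorem efron_stein (μ : Measure X) [IsProbabilityMeasure μ] (p : X) (n : ℕ)
    {F : (Fin n → X) → ℝ} (hF : Measurable F) {C : ℝ} (hC : ∀ x, |F x| ≤ C) :
    ∫ x, F x ^ 2 ∂(Measure.pi fun _ : Fin n => μ) - (∫ x, F x ∂(Measure.pi fun _ : Fin n => μ)) ^ 2
      ≤ ∑ j, ∫ x, (F x - F (Function.update x j p)) ^ 2 ∂(Measure.pi fun _ : Fin n => μ) := by
  induction n with
  | zero =>
    have h : ∀ x, F x = F fun i => i.elim0 := fun x => congrArg F (Subsingleton.elim _ _)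
    simp_rw [h]
    simp
  | succ n ih =>
    set ν : Measure (Fin n → X) := Measure.pi fun _ : Fin n => μ
    have hC2 : ∀ x, |F x ^ 2| ≤ C ^ 2 := fun x => by
      rw [abs_pow]
      exact pow_le_pow_left₀ (abs_nonneg _) (hC x) 2
    have hupd : ∀ j, Measurable fun x => F (Function.update x j p) := fun j =>
      hF.comp (by fun_prop)
    have hD : ∀ j, Measurable fun x => (F x - F (Function.update x j p)) ^ 2 := fun j =>
      (hF.sub (hupd j)).pow_const 2
    have hDC : ∀ j x, |(F x - F (Function.update x j p)) ^ 2| ≤ (2 * C) ^ 2 := fun j x => by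
      rw [abs_pow]
      refine pow_le_pow_left₀ (abs_nonneg _) ((abs_sub _ _).trans ?_) 2
      linarith [hC x, hC (Function.update x j p)]
    have hcons : ∀ x₀ : X, Measurable fun y : Fin n → X => (Fin.cons x₀ y : Fin (n + 1) → X) :=
      fun x₀ => (measurable_finCons n).comp measurable_prodMk_left
    -- Conditional mean given the first coordinate. The variance of F is the mean conditional
    -- variance, bounded fibrewise by induction (`hfirst`), plus the variance of `h` (`hsecond`).
    set h : X → ℝ := fun x₀ => ∫ y, F (Fin.cons x₀ y) ∂ν with hh
    have hhm : Measurable h := measurable_integral_finCons μ n hF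
    have hhC : ∀ x₀, |h x₀| ≤ C := fun x₀ =>
      abs_integral_le_of_abs_le ν fun y => hC (Fin.cons x₀ y)
    have hhi : Integrable (fun x₀ => h x₀ ^ 2) μ :=
      integrable_of_measurable_of_abs_le (C := C ^ 2) (hhm.pow_const 2) fun x => by
        rw [abs_pow]
        exact pow_le_pow_left₀ (abs_nonneg _) (hhC x) 2
    have hFi : Integrable (fun x₀ => ∫ y, F (Fin.cons x₀ y) ^ 2 ∂ν) μ :=
      integrable_of_measurable_of_abs_le (C := C ^ 2)
        (measurable_integral_finCons μ n (hF.pow_const 2)) fun x₀ =>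
          abs_integral_le_of_abs_le ν fun y => hC2 (Fin.cons x₀ y)
    have hDi : ∀ j, Integrable (fun x₀ => ∫ y, (F (Fin.cons x₀ y)
        - F (Function.update (Fin.cons x₀ y : Fin (n + 1) → X) j p)) ^ 2 ∂ν) μ := fun j =>
      integrable_of_measurable_of_abs_le (C := (2 * C) ^ 2)
        (measurable_integral_finCons μ n (hD j)) fun x₀ =>
          abs_integral_le_of_abs_le ν fun y => hDC j (Fin.cons x₀ y)
    rw [integral_pi_succ μ n (hF.pow_const 2) hC2, integral_pi_succ μ n hF hC, Fin.sum_univ_succ]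
    simp_rw [integral_pi_succ μ n (hD _) (hDC _)]
    have hfirst : ∫ x₀, ∫ y, F (Fin.cons x₀ y) ^ 2 ∂ν ∂μ - ∫ x₀, h x₀ ^ 2 ∂μ
        ≤ ∑ j : Fin n, ∫ x₀, ∫ y, (F (Fin.cons x₀ y)
          - F (Function.update (Fin.cons x₀ y : Fin (n + 1) → X) j.succ p)) ^ 2 ∂ν ∂μ := by
      rw [← integral_sub hFi hhi, ← integral_finsetSum _ fun j _ => hDi j.succ]
      refine integral_mono (hFi.sub hhi) (integrable_finsetSum _ fun j _ => hDi j.succ) fun x₀ => ?_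
      refine (ih (hF.comp (hcons x₀)) fun y => hC _).trans_eq ?_
      refine Finset.sum_congr rfl fun j _ => ?_
      simp only [Fin.cons_update, Function.comp_apply]
    -- Compare `h` with its value at `p`, then use Jensen in `y`, in the form that a variance is
    -- nonnegative.
    have hsecond : ∫ x₀, h x₀ ^ 2 ∂μ - (∫ x₀, h x₀ ∂μ) ^ 2
        ≤ ∫ x₀, ∫ y, (F (Fin.cons x₀ y)
          - F (Function.update (Fin.cons x₀ y : Fin (n + 1) → X) 0 p)) ^ 2 ∂ν ∂μ := by
      refine (integral_sq_sub_sq_integral_le μ hhm hhC (h p)).trans ?_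
      refine integral_mono ?_ (hDi 0) fun x₀ => ?_
      · refine integrable_of_measurable_of_abs_le (C := (2 * C) ^ 2)
          ((hhm.sub_const _).pow_const 2) fun x => ?_
        rw [abs_pow]
        refine pow_le_pow_left₀ (abs_nonneg _) ((abs_sub _ _).trans ?_) 2
        linarith [hhC x, hhC p]
      · simp only [Fin.update_cons_zero]
        have hsub : h x₀ - h p = ∫ y, (F (Fin.cons x₀ y) - F (Fin.cons p y)) ∂ν := by
          rw [hh, integral_sub]
          · exact integrable_of_measurable_of_abs_le (hF.comp (hcons x₀)) fun y => hC _
          · exact integrable_of_measurable_of_abs_le (hF.comp (hcons p)) fun y => hC _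
        rw [hsub]
        have hvar : 0 ≤ ∫ y, (F (Fin.cons x₀ y) - F (Fin.cons p y)) ^ 2 ∂ν
            - (∫ y, (F (Fin.cons x₀ y) - F (Fin.cons p y)) ∂ν) ^ 2 := by
          set f : (Fin n → X) → ℝ := fun y => F (Fin.cons x₀ y) - F (Fin.cons p y) with hf
          have hfm : Measurable f := (hF.comp (hcons x₀)).sub (hF.comp (hcons p))
          have hmem : MemLp f 2 ν := MemLp.of_bound hfm.aestronglyMeasurable (2 * C)
            (Eventually.of_forall fun y => by
              refine (abs_sub _ _).trans ?_
              linarith [hC (Fin.cons x₀ y), hC (Fin.cons p y)])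
          have := variance_nonneg f ν
          rw [variance_eq_sub hmem] at this
          simpa using this
        linarith
    linarith

/-- If the squared one-coordinate increments of `F` sum to at most `K`, the fourth central moment
of `F` is of order `K²`. -/
theorem integral_sub_mean_pow_four_le (μ : Measure X) [IsProbabilityMeasure μ] (p : X) (n : ℕ)
    {F : (Fin n → X) → ℝ} (hF : Measurable F) {C : ℝ} (hC : ∀ x, |F x| ≤ C) {K : ℝ}
    (hK : ∀ x, ∑ j, (F x - F (Function.update x j p)) ^ 2 ≤ K) :
    ∫ x, (F x - ∫ z, F z ∂(Measure.pi fun _ : Fin n => μ)) ^ 4 ∂(Measure.pi fun _ : Fin n => μ)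
      ≤ 11 * K ^ 2 := by
  set ν : Measure (Fin n → X) := Measure.pi fun _ : Fin n => μ
  set c : ℝ := ∫ z, F z ∂ν with hc
  have hcC : |c| ≤ C := abs_integral_le_of_abs_le ν hC
  obtain ⟨x₁⟩ : Nonempty (Fin n → X) := ν.nonempty_of_neZero
  have hK0 : 0 ≤ K := (Finset.sum_nonneg fun j _ => sq_nonneg _).trans (hK x₁)
  -- The fourth central moment is Var G + (∫ G)². Efron–Stein for F gives ∫ G ≤ K, and for G it
  -- gives Var G ≤ 10 K², whence 11.
  set G : (Fin n → X) → ℝ := fun x => (F x - c) ^ 2 with hG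
  have hGm : Measurable G := (hF.sub_const c).pow_const 2
  have hGC : ∀ x, |G x| ≤ (2 * C) ^ 2 := fun x => by
    rw [hG, abs_pow]
    refine pow_le_pow_left₀ (abs_nonneg _) ((abs_sub _ _).trans ?_) 2
    linarith [hC x]
  have hupd : ∀ j, Measurable fun x : Fin n → X => Function.update x j p := fun j => by fun_prop
  have hinc : ∀ {H : (Fin n → X) → ℝ} {B : ℝ}, Measurable H → (∀ x, |H x| ≤ B) → ∀ j,
      Integrable (fun x => (H x - H (Function.update x j p)) ^ 2) ν := by
    intro H B hH hB j
    refine integrable_of_measurable_of_abs_le (C := (2 * B) ^ 2)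
      ((hH.sub (hH.comp (hupd j))).pow_const 2) fun x => ?_
    rw [abs_pow]
    refine pow_le_pow_left₀ (abs_nonneg _) ((abs_sub _ _).trans ?_) 2
    linarith [hB x, hB (Function.update x j p)]
  have hGi : Integrable G ν := integrable_of_measurable_of_abs_le hGm hGC
  have hFi : Integrable F ν := integrable_of_measurable_of_abs_le hF hC
  have hF2i : Integrable (fun x => F x ^ 2) ν :=
    integrable_of_measurable_of_abs_le (C := C ^ 2) (hF.pow_const 2) fun x => by
      rw [abs_pow]
      exact pow_le_pow_left₀ (abs_nonneg _) (hC x) 2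
  have hGint : ∫ x, G x ∂ν ≤ K := by
    have e : ∫ x, G x ∂ν = ∫ x, F x ^ 2 ∂ν - c ^ 2 := by
      rw [hG, integral_sub_const_sq ν hFi hF2i, ← hc]
      ring
    rw [e]
    refine (efron_stein μ p n hF hC).trans ?_
    rw [← integral_finsetSum _ fun j _ => hinc hF hC j]
    calc _ ≤ ∫ _x, K ∂ν := integral_mono (integrable_finsetSum _ fun j _ => hinc hF hC j)
          (integrable_const _) hK
      _ = K := by simp
  have hG0 : 0 ≤ ∫ x, G x ∂ν := integral_nonneg fun x => sq_nonneg _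
  -- With a = F - c and d an increment of F, the increment of G is d(2a - d), and (2a - d)² ≤ 8a² +
  -- 2d² where d² ≤ K.
  have hpt : ∀ x, ∑ j, (G x - G (Function.update x j p)) ^ 2 ≤ K * (8 * G x + 2 * K) := by
    intro x
    have hGx : 0 ≤ G x := sq_nonneg _
    calc _ ≤ ∑ j, (F x - F (Function.update x j p)) ^ 2 * (8 * G x + 2 * K) := by
          refine Finset.sum_le_sum fun j _ => ?_
          have hj : (F x - F (Function.update x j p)) ^ 2 ≤ K :=
            (Finset.single_le_sum (f := fun j => (F x - F (Function.update x j p)) ^ 2)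
              (fun i _ => sq_nonneg _) (Finset.mem_univ j)).trans (hK x)
          have e : (G x - G (Function.update x j p)) ^ 2 = (F x - F (Function.update x j p)) ^ 2
              * (2 * (F x - c) - (F x - F (Function.update x j p))) ^ 2 := by
            simp only [hG]
            ring
          rw [e]
          refine mul_le_mul_of_nonneg_left ?_ (sq_nonneg _)
          have : G x = (F x - c) ^ 2 := rfl
          nlinarith [sq_nonneg (2 * (F x - c) + (F x - F (Function.update x j p)))]
      _ = (∑ j, (F x - F (Function.update x j p)) ^ 2) * (8 * G x + 2 * K) := by
          rw [Finset.sum_mul]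
      _ ≤ _ := mul_le_mul_of_nonneg_right (hK x) (by positivity)
  have hES := efron_stein μ p n hGm hGC
  rw [← integral_finsetSum _ fun j _ => hinc hGm hGC j] at hES
  have hbd : ∫ x, ∑ j, (G x - G (Function.update x j p)) ^ 2 ∂ν ≤ 10 * K ^ 2 := by
    calc _ ≤ ∫ x, K * (8 * G x + 2 * K) ∂ν :=
          integral_mono (integrable_finsetSum _ fun j _ => hinc hGm hGC j)
            (((hGi.const_mul 8).add (integrable_const _)).const_mul K) hpt
      _ = K * (8 * ∫ x, G x ∂ν + 2 * K) := by
          rw [integral_const_mul, integral_add (hGi.const_mul 8) (integrable_const _),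
            integral_const_mul]
          simp
      _ ≤ K * (8 * K + 2 * K) := by gcongr
      _ = _ := by ring
  have e4 : ∀ x, (F x - c) ^ 4 = G x ^ 2 := fun x => by simp only [hG]; ring
  simp_rw [e4]
  have : (∫ x, G x ∂ν) ^ 2 ≤ K ^ 2 := pow_le_pow_left₀ hG0 hGint 2
  linarith

end EfronStein

/-! ### Almost sure concentration for bounded inputs. -/

section Concentration

open Complex

/-- Real part of e^{iu}(e^{id} - 1 - id). For |d| > 1 the triangle inequality gives 2 + |d| ≤ 3d²,
so no smallness of `d` is needed. -/
theorem abs_cos_add_sub_le (u d : ℝ) :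
    |Real.cos (u + d) - Real.cos u + d * Real.sin u| ≤ 3 * d ^ 2 := by
  have h1 : ‖exp (d * I) - 1 - d * I‖ ≤ 3 * d ^ 2 := by
    rcases le_or_gt |d| 1 with hd | hd
    · refine (norm_exp_sub_one_sub_id_le (x := d * I) (by simpa using hd)).trans ?_
      simp only [norm_mul, norm_real, Real.norm_eq_abs, norm_I, mul_one, sq_abs]
      nlinarith [sq_nonneg d]
    · refine (norm_sub_le _ _).trans ?_
      refine (add_le_add (norm_sub_le _ _) le_rfl).trans ?_
      rw [norm_exp_ofReal_mul_I]
      simp only [norm_mul, norm_real, Real.norm_eq_abs, norm_I, mul_one, norm_one]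
      nlinarith [sq_abs d]
  have h2 : Real.cos (u + d) - Real.cos u + d * Real.sin u
      = (exp (u * I) * (exp (d * I) - 1 - d * I)).re := by
    rw [exp_mul_I, exp_mul_I, Real.cos_add]
    simp only [mul_re, sub_re, sub_im, add_re, add_im, mul_im, cos_ofReal_re, cos_ofReal_im,
      sin_ofReal_re, sin_ofReal_im, I_re, I_im, one_re, one_im, ofReal_re, ofReal_im]
    ring
  rw [h2]
  refine (abs_re_le_norm _).trans ?_
  rwa [norm_mul, norm_exp_ofReal_mul_I, one_mul]

/-- The average over the roots of `-1` of the cosine of a shifted linear form. -/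
noncomputable def averageCos (n : ℕ) (t : ℂ) (θ : ℝ) (y : Fin n → ℝ) : ℝ :=
  (n : ℝ)⁻¹ * ∑ k : Fin n, Real.cos (θ + ∑ j, y j * skewCoeff n k t j)

theorem measurable_averageCos (n : ℕ) (t : ℂ) (θ : ℝ) : Measurable (averageCos n t θ) := by
  unfold averageCos
  fun_prop

theorem abs_averageCos_le (n : ℕ) (t : ℂ) (θ : ℝ) (y : Fin n → ℝ) : |averageCos n t θ y| ≤ 1 := by
  rw [averageCos, abs_mul, abs_of_nonneg (by positivity)]
  rcases Nat.eq_zero_or_pos n with rfl | hn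
  · simp
  have hn' : (0 : ℝ) < n := Nat.cast_pos.2 hn
  rw [inv_mul_le_iff₀ hn', mul_one]
  refine (Finset.abs_sum_le_sum_abs _ _).trans ((Finset.sum_le_sum fun k _ =>
    Real.abs_cos_le_one _).trans_eq ?_)
  simp

/-- Parseval in the frequency variable. Bounding each inner sum by absolute values would give n² in
place of n, and no concentration would follow. -/
theorem sum_sq_sum_mul_skewCoeff_le (n : ℕ) (t : ℂ) (s : Fin n → ℝ) (hs : ∀ k, |s k| ≤ 1) :
    ∑ j, (∑ k, s k * skewCoeff n k t j) ^ 2 ≤ ‖t‖ ^ 2 * n := by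
  rcases Nat.eq_zero_or_pos n with rfl | hn
  · simp
  have hn' : (0 : ℝ) < n := Nat.cast_pos.2 hn
  have e : ∀ j, ∑ k, s k * skewCoeff n k t j
      = (Real.sqrt n)⁻¹ * inner ℝ (∑ k, (s k : ℂ) * skewRoot n k ^ (j : ℕ)) t := by
    intro j
    rw [sum_inner, Finset.mul_sum]
    refine Finset.sum_congr rfl fun k _ => ?_
    rw [← real_smul, real_inner_smul_left, skewCoeff]
    ring
  calc _ ≤ ∑ j : Fin n, (n : ℝ)⁻¹ * ‖t‖ ^ 2
          * ‖∑ k, (s k : ℂ) * skewRoot n k ^ (j : ℕ)‖ ^ 2 := by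
        refine Finset.sum_le_sum fun j _ => ?_
        rw [e, mul_pow, inv_pow, Real.sq_sqrt hn'.le, mul_assoc]
        refine mul_le_mul_of_nonneg_left ?_ (by positivity)
        rw [← sq_abs, mul_comm, ← mul_pow]
        exact pow_le_pow_left₀ (abs_nonneg _) (abs_real_inner_le_norm _ _) 2
    _ = ‖t‖ ^ 2 * ∑ k, ‖(s k : ℂ)‖ ^ 2 := by
        rw [← Finset.mul_sum, sum_norm_sq_sum_mul_skewRoot_pow]
        field_simp
    _ ≤ ‖t‖ ^ 2 * ∑ _k : Fin n, 1 := by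
        gcongr with k
        rw [norm_real, Real.norm_eq_abs]
        exact pow_le_one₀ (abs_nonneg _) (hs k)
    _ = _ := by simp

/-- Linearize each increment as n⁻¹(w - y_j) T_j plus a remainder of size at most R = O(1/n).
Parseval gives ∑ T_j² = O(n), so both parts contribute O(1/n) to the sum of squares. The constants
are 8 = 2·2² and 288 = 2·12², with 12 = 3·2² from `abs_cos_add_sub_le`. -/
theorem sum_sq_averageCos_sub_update_le (n : ℕ) (t : ℂ) (θ : ℝ) {B : ℝ} (y : Fin n → ℝ) (w : ℝ)
    (hy : ∀ j, |y j| ≤ B) (hw : |w| ≤ B) :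
    ∑ j, (averageCos n t θ y - averageCos n t θ (Function.update y j w)) ^ 2
      ≤ (8 * B ^ 2 * ‖t‖ ^ 2 + 288 * B ^ 4 * ‖t‖ ^ 4) * (n : ℝ)⁻¹ := by
  rcases Nat.eq_zero_or_pos n with rfl | hn
  · simp
  have hn' : (0 : ℝ) < n := Nat.cast_pos.2 hn
  set u : Fin n → ℝ := fun k => θ + ∑ j, y j * skewCoeff n k t j with hu
  set T : Fin n → ℝ := fun j => ∑ k, Real.sin (u k) * skewCoeff n k t j with hT
  have hTsum : ∑ j, T j ^ 2 ≤ ‖t‖ ^ 2 * n :=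
    sum_sq_sum_mul_skewCoeff_le n t (fun k => Real.sin (u k)) fun k => Real.abs_sin_le_one _
  have hδ : ∀ j, |w - y j| ≤ 2 * B := fun j => (abs_sub _ _).trans (by linarith [hy j])
  have hB : 0 ≤ B := (abs_nonneg _).trans hw
  have hupd : ∀ j k, θ + ∑ i, Function.update y j w i * skewCoeff n k t i
      = u k + (w - y j) * skewCoeff n k t j := by
    intro j k
    rw [hu]
    beta_reduce
    rw [← Finset.add_sum_erase _ _ (Finset.mem_univ j),
      ← Finset.add_sum_erase _ (fun i => y i * skewCoeff n k t i) (Finset.mem_univ j),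
      Function.update_self]
    have : ∑ i ∈ Finset.univ.erase j, Function.update y j w i * skewCoeff n k t i
        = ∑ i ∈ Finset.univ.erase j, y i * skewCoeff n k t i := by
      refine Finset.sum_congr rfl fun i hi => ?_
      rw [Function.update_of_ne (Finset.ne_of_mem_erase hi)]
    rw [this]
    ring
  set R : ℝ := 12 * B ^ 2 * ‖t‖ ^ 2 * (n : ℝ)⁻¹ with hR
  have hmain : ∀ j, |averageCos n t θ y - averageCos n t θ (Function.update y j w)
      - (n : ℝ)⁻¹ * (w - y j) * T j| ≤ R := by
    intro j
    have e : averageCos n t θ y - averageCos n t θ (Function.update y j w)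
        - (n : ℝ)⁻¹ * (w - y j) * T j
        = -((n : ℝ)⁻¹ * ∑ k, (Real.cos (u k + (w - y j) * skewCoeff n k t j) - Real.cos (u k)
          + (w - y j) * skewCoeff n k t j * Real.sin (u k))) := by
      simp only [averageCos, hupd, Finset.sum_add_distrib, Finset.sum_sub_distrib, hT]
      have : ∑ k, (w - y j) * skewCoeff n k t j * Real.sin (u k)
          = (w - y j) * ∑ k, Real.sin (u k) * skewCoeff n k t j := by
        rw [Finset.mul_sum]
        exact Finset.sum_congr rfl fun k _ => by ring
      rw [this]
      ring
    rw [e, abs_neg, abs_mul, abs_of_nonneg (by positivity : 0 ≤ (n : ℝ)⁻¹),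
      inv_mul_le_iff₀ hn']
    have hk : ∀ k, |Real.cos (u k + (w - y j) * skewCoeff n k t j) - Real.cos (u k)
          + (w - y j) * skewCoeff n k t j * Real.sin (u k)| ≤ R := by
      intro k
      refine (abs_cos_add_sub_le _ _).trans ?_
      have h1 : (w - y j) ^ 2 ≤ (2 * B) ^ 2 := sq_le_sq' (abs_le.1 (hδ j)).1 (abs_le.1 (hδ j)).2
      have h2 : skewCoeff n k t j ^ 2 ≤ (n : ℝ)⁻¹ * ‖t‖ ^ 2 := by
        rw [← sq_abs]
        refine (pow_le_pow_left₀ (abs_nonneg _) (abs_skewCoeff_le n k t j) 2).trans_eq ?_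
        rw [mul_pow, inv_pow, Real.sq_sqrt hn'.le]
      rw [mul_pow]
      calc 3 * ((w - y j) ^ 2 * skewCoeff n k t j ^ 2)
          ≤ 3 * ((2 * B) ^ 2 * ((n : ℝ)⁻¹ * ‖t‖ ^ 2)) := by gcongr
        _ = R := by rw [hR]; ring
    refine (Finset.abs_sum_le_sum_abs _ _).trans ((Finset.sum_le_sum fun k _ => hk k).trans_eq ?_)
    simp
  calc _ ≤ ∑ j, (8 * B ^ 2 * ((n : ℝ)⁻¹) ^ 2 * T j ^ 2 + 2 * R ^ 2) := by
        refine Finset.sum_le_sum fun j _ => ?_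
        set D := averageCos n t θ y - averageCos n t θ (Function.update y j w)
        set Q := (n : ℝ)⁻¹ * (w - y j) * T j with hQ
        have h1 : (D - Q) ^ 2 ≤ R ^ 2 := sq_le_sq' (abs_le.1 (hmain j)).1 (abs_le.1 (hmain j)).2
        have h2 : Q ^ 2 ≤ (2 * B) ^ 2 * (((n : ℝ)⁻¹) ^ 2 * T j ^ 2) := by
          have h3 : (w - y j) ^ 2 ≤ (2 * B) ^ 2 := sq_le_sq' (abs_le.1 (hδ j)).1 (abs_le.1 (hδ j)).2
          calc Q ^ 2 = (w - y j) ^ 2 * (((n : ℝ)⁻¹) ^ 2 * T j ^ 2) := by rw [hQ]; ring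
            _ ≤ _ := by gcongr
        nlinarith [sq_nonneg (D - 2 * Q)]
    _ = 8 * B ^ 2 * ((n : ℝ)⁻¹) ^ 2 * ∑ j, T j ^ 2 + n * (2 * R ^ 2) := by
        rw [Finset.sum_add_distrib, ← Finset.mul_sum]
        simp
    _ ≤ 8 * B ^ 2 * ((n : ℝ)⁻¹) ^ 2 * (‖t‖ ^ 2 * n) + n * (2 * R ^ 2) := by gcongr
    _ = _ := by
        rw [hR]
        field_simp
        ring

variable {Ω : Type*} [MeasurableSpace Ω]

/-- The fourth moments are summable, so ∑ X_n⁴ has finite expectation and is almost surely finite. A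
variance bound of order 1/n would not be summable. -/
theorem ae_tendsto_zero_of_integral_pow_four_le {P : Measure Ω} [IsProbabilityMeasure P]
    {X : ℕ → Ω → ℝ} (hX : ∀ n, Measurable (X n)) {B : ℝ} (hB : ∀ n ω, |X n ω| ≤ B) {C : ℝ}
    (hC : ∀ n, ∫ ω, X n ω ^ 4 ∂P ≤ C * (((n + 1 : ℕ) : ℝ)⁻¹) ^ 2) :
    ∀ᵐ ω ∂P, Tendsto (fun n => X n ω) atTop (𝓝 0) := by
  have hsummable : Summable fun n : ℕ => C * (((n + 1 : ℕ) : ℝ)⁻¹) ^ 2 := by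
    have h : Summable fun n : ℕ => ((n : ℝ) ^ 2)⁻¹ := Real.summable_nat_pow_inv.2 one_lt_two
    have h2 := (summable_nat_add_iff 1).2 h
    simpa only [inv_pow] using h2.mul_left C
  have hint : ∀ n, Integrable (fun ω => X n ω ^ 4) P := fun n =>
    integrable_of_measurable_of_abs_le (C := B ^ 4) ((hX n).pow_const 4) fun ω => by
      rw [abs_pow]
      exact pow_le_pow_left₀ (abs_nonneg _) (hB n ω) 4
  have hnn : ∀ n ω, 0 ≤ X n ω ^ 4 := fun n ω => by positivity
  have hfin : ∫⁻ ω, ∑' n, ENNReal.ofReal (X n ω ^ 4) ∂P ≠ ⊤ := by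
    rw [lintegral_tsum fun n => ((hX n).pow_const 4).ennreal_ofReal.aemeasurable]
    refine ne_top_of_le_ne_top hsummable.tsum_ofReal_ne_top ?_
    refine ENNReal.tsum_le_tsum fun n => ?_
    rw [← ofReal_integral_eq_lintegral_ofReal (hint n) (Eventually.of_forall (hnn n))]
    exact ENNReal.ofReal_le_ofReal (hC n)
  have hae := ae_lt_top' (AEMeasurable.tsum
    fun n => ((hX n).pow_const 4).ennreal_ofReal.aemeasurable) hfin
  filter_upwards [hae] with ω hω
  have h1 := ENNReal.tendsto_atTop_zero_of_tsum_ne_top hω.ne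
  have h2 : Tendsto (fun n => X n ω ^ 4) atTop (𝓝 0) := by
    have := (ENNReal.tendsto_toReal ENNReal.zero_ne_top).comp h1
    simpa [Function.comp_def, ENNReal.toReal_ofReal (hnn _ ω)] using this
  have h3 := h2.sqrt.sqrt
  rw [Real.sqrt_zero, Real.sqrt_zero] at h3
  have h4 : ∀ n, Real.sqrt (Real.sqrt (X n ω ^ 4)) = |X n ω| := fun n => by
    rw [show X n ω ^ 4 = (X n ω ^ 2) ^ 2 by ring, Real.sqrt_sq (sq_nonneg _), Real.sqrt_sq_eq_abs]
  simp_rw [h4] at h3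
  exact (tendsto_zero_iff_abs_tendsto_zero _).2 h3

/-- The vector of inputs has a product law, on which `integral_sub_mean_pow_four_le` applies with
K/n; the fourth central moment is then O(n^{-2}). -/
theorem ae_tendsto_averageCos_sub_integral {P : Measure Ω} [IsProbabilityMeasure P]
    {l : ℕ → Ω → ℝ} (hm : ∀ j, Measurable (l j)) (hi : iIndepFun l P)
    (hd : ∀ j, IdentDistrib (l j) (l 0) P P) {h : ℝ → ℝ} (hh : Measurable h) {B : ℝ}
    (hB : ∀ x, |h x| ≤ B) (t : ℂ) (θ : ℝ) :
    ∀ᵐ ω ∂P, Tendsto (fun n : ℕ => averageCos (n + 1) t θ (fun j => h (l j ω))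
      - ∫ ω', averageCos (n + 1) t θ (fun j => h (l j ω')) ∂P) atTop (𝓝 0) := by
  set K : ℝ := 8 * B ^ 2 * ‖t‖ ^ 2 + 288 * B ^ 4 * ‖t‖ ^ 4
  have hvec : ∀ n : ℕ, Measurable fun ω => fun j : Fin n => l j ω := fun n =>
    measurable_pi_lambda _ fun j => hm j
  have hcomp : ∀ n : ℕ, Measurable fun x : Fin n → ℝ => averageCos n t θ fun j => h (x j) :=
    fun n =>
    (measurable_averageCos n t θ).comp (by fun_prop)
  have hmap : ∀ n : ℕ, P.map (fun ω => fun j : Fin n => l j ω)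
      = Measure.pi fun _ : Fin n => P.map (l 0) := by
    intro n
    have := (iIndepFun_iff_map_fun_eq_pi_map (f := fun j : Fin n => l j)
      fun j => (hm j).aemeasurable).1 (hi.precomp Fin.val_injective)
    rw [this]
    congr 1
    funext j
    exact (hd j).map_eq
  have : IsProbabilityMeasure (P.map (l 0)) := Measure.isProbabilityMeasure_map (hm 0).aemeasurable
  have hint : ∀ (n : ℕ) (g : (Fin n → ℝ) → ℝ), Measurable g →
      ∫ ω, g (fun j : Fin n => l j ω) ∂P = ∫ x, g x ∂(Measure.pi fun _ : Fin n => P.map (l 0)) := by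
    intro n g hg
    rw [← hmap n, integral_map (hvec n).aemeasurable hg.aestronglyMeasurable]
  have hE : ∀ n : ℕ, |∫ ω', averageCos n t θ (fun j => h (l j ω')) ∂P| ≤ 1 := fun n =>
    abs_integral_le_of_abs_le P fun ω => abs_averageCos_le n t θ fun j => h (l j ω)
  refine ae_tendsto_zero_of_integral_pow_four_le (B := 2) (C := 11 * K ^ 2)
    (fun n => ((hcomp (n + 1)).comp (hvec (n + 1))).sub_const _) (fun n ω => ?_) fun n => ?_
  · refine (abs_sub _ _).trans ?_
    linarith [abs_averageCos_le (n + 1) t θ (fun j => h (l j ω)), hE (n + 1)]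
  · have e := hint (n + 1) (fun x => averageCos (n + 1) t θ fun j => h (x j)) (hcomp (n + 1))
    have e4 := hint (n + 1) (fun x => (averageCos (n + 1) t θ (fun j => h (x j))
      - ∫ ω', averageCos (n + 1) t θ (fun j => h (l j ω')) ∂P) ^ 4)
      (((hcomp (n + 1)).sub_const _).pow_const 4)
    refine e4.trans_le ?_
    rw [e]
    refine (integral_sub_mean_pow_four_le (P.map (l 0)) 0 (n + 1) (hcomp (n + 1))
      (fun x => abs_averageCos_le (n + 1) t θ _) (K := K * ((n + 1 : ℕ) : ℝ)⁻¹)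
      fun x => ?_).trans_eq
        (by ring)
    have hu : ∀ j, (fun i => h (Function.update x j 0 i))
        = Function.update (fun i => h (x i)) j (h 0) := by
      intro j
      funext i
      exact Function.apply_update (fun _ => h) x j 0 i
    simp_rw [hu]
    exact sum_sq_averageCos_sub_update_le (n + 1) t θ _ (h 0) (fun j => hB _) (hB 0)

end Concentration

/-! ### Stability of the empirical characteristic function, and the bounded case. -/

section Approximation

open Complex

/-- The three-term estimate, needed twice: to remove the truncation, and to pass from a dense set of
`t` to all `t`. -/
theorem tendsto_of_forall_approx {E : Type*} [SeminormedAddCommGroup E] {x : ℕ → E} {a : E}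
    (h : ∀ ε > 0, ∃ (y : ℕ → E) (b : E), Tendsto y atTop (𝓝 b) ∧ ‖b - a‖ ≤ ε ∧
      ∀ᶠ n in atTop, ‖x n - y n‖ ≤ ε) : Tendsto x atTop (𝓝 a) := by
  rw [Metric.tendsto_nhds]
  intro ε hε
  obtain ⟨y, b, hy, hb, hxy⟩ := h (ε / 4) (by positivity)
  have h1 := Metric.tendsto_nhds.1 hy (ε / 4) (by positivity)
  filter_upwards [h1, hxy] with n h1 h2
  rw [dist_eq_norm] at h1 ⊢
  calc ‖x n - a‖ = ‖(x n - y n) + (y n - b) + (b - a)‖ := by congr 1; abel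
    _ ≤ ‖x n - y n‖ + ‖y n - b‖ + ‖b - a‖ := norm_add₃_le
    _ < ε := by linarith

theorem norm_exp_mul_I_sub_exp_mul_I_le (a b : ℝ) : ‖exp (a * I) - exp (b * I)‖ ≤ |a - b| := by
  have e : exp (a * I) - exp (b * I) = exp (b * I) * (exp (I * (a - b : ℝ)) - 1) := by
    rw [mul_sub, ← exp_add, mul_one]
    congr 2
    push_cast
    ring
  rw [e, norm_mul, norm_exp_ofReal_mul_I, one_mul]
  exact Real.norm_exp_I_mul_ofReal_sub_one_le

/-- The characteristic function of the empirical measure of the normalized Fourier transform. -/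
noncomputable def empiricalCharFun (n : ℕ) (y : ℕ → ℝ) (t : ℂ) : ℂ :=
  (n : ℂ)⁻¹ * ∑ k : Fin n, exp ((inner ℝ (normalizedSkewFourier n y k) t : ℝ) * I)

/-- Cauchy–Schwarz over the frequencies, then Parseval. The right side is an empirical mean square,
to which the strong law applies. -/
theorem average_norm_normalizedSkewFourier_le (n : ℕ) (y : ℕ → ℝ) :
    (n : ℝ)⁻¹ * ∑ k : Fin n, ‖normalizedSkewFourier n y k‖
      ≤ Real.sqrt ((∑ j ∈ Finset.range n, y j ^ 2) / n) := by
  rcases Nat.eq_zero_or_pos n with rfl | hn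
  · simp
  have hn' : (0 : ℝ) < n := Nat.cast_pos.2 hn
  apply Real.le_sqrt_of_sq_le
  have h1 := sq_sum_le_card_mul_sum_sq (s := (Finset.univ : Finset (Fin n)))
    (f := fun k => ‖normalizedSkewFourier n y k‖)
  have h2 : ∑ k, ‖normalizedSkewFourier n y k‖ ^ 2 = ∑ j ∈ Finset.range n, y j ^ 2 := by
    rw [← Fin.sum_univ_eq_sum_range fun j => y j ^ 2]
    unfold normalizedSkewFourier
    rw [sum_norm_sq_skewFourier]
    simp only [Pi.smul_apply, smul_eq_mul, mul_pow, inv_pow, Real.sq_sqrt hn'.le]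
    rw [← Finset.mul_sum, mul_inv_cancel_left₀ hn'.ne']
  rw [h2, Finset.card_univ, Fintype.card_fin] at h1
  rw [mul_pow]
  calc _ ≤ ((n : ℝ)⁻¹) ^ 2 * (n * ∑ j ∈ Finset.range n, y j ^ 2) := by gcongr
    _ = _ := by field_simp

theorem norm_average_exp_sub_le (n : ℕ) (a b : Fin n → ℝ) :
    ‖(n : ℂ)⁻¹ * ∑ k, exp (a k * I) - (n : ℂ)⁻¹ * ∑ k, exp (b k * I)‖
      ≤ (n : ℝ)⁻¹ * ∑ k, |a k - b k| := by
  rw [← mul_sub, ← Finset.sum_sub_distrib, norm_mul, norm_inv, norm_natCast]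
  gcongr
  exact (norm_sum_le _ _).trans (Finset.sum_le_sum fun k _ => norm_exp_mul_I_sub_exp_mul_I_le _ _)

theorem norm_empiricalCharFun_sub_le (n : ℕ) (y z : ℕ → ℝ) (t : ℂ) :
    ‖empiricalCharFun n y t - empiricalCharFun n z t‖
      ≤ Real.sqrt ((∑ j ∈ Finset.range n, (y j - z j) ^ 2) / n) * ‖t‖ := by
  refine (norm_average_exp_sub_le n _ _).trans ?_
  calc _ ≤ (n : ℝ)⁻¹ * ∑ k : Fin n, ‖normalizedSkewFourier n (y - z) k‖ * ‖t‖ := by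
        gcongr with k
        rw [← inner_sub_left]
        have : normalizedSkewFourier n y k - normalizedSkewFourier n z k
            = normalizedSkewFourier n (y - z) k := by
          rw [normalizedSkewFourier, normalizedSkewFourier, normalizedSkewFourier, smul_sub,
            skewFourier_sub]
        rw [this]
        exact abs_real_inner_le_norm _ _
    _ = ((n : ℝ)⁻¹ * ∑ k : Fin n, ‖normalizedSkewFourier n (y - z) k‖) * ‖t‖ := by
        rw [← Finset.sum_mul, mul_assoc]
    _ ≤ _ := by
        gcongr
        exact average_norm_normalizedSkewFourier_le n (y - z)

theorem norm_empiricalCharFun_sub_le' (n : ℕ) (y : ℕ → ℝ) (s t : ℂ) :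
    ‖empiricalCharFun n y s - empiricalCharFun n y t‖
      ≤ Real.sqrt ((∑ j ∈ Finset.range n, y j ^ 2) / n) * ‖s - t‖ := by
  refine (norm_average_exp_sub_le n _ _).trans ?_
  calc _ ≤ (n : ℝ)⁻¹ * ∑ k : Fin n, ‖normalizedSkewFourier n y k‖ * ‖s - t‖ := by
        gcongr with k
        rw [← inner_sub_right]
        exact abs_real_inner_le_norm _ _
    _ = ((n : ℝ)⁻¹ * ∑ k : Fin n, ‖normalizedSkewFourier n y k‖) * ‖s - t‖ := by
        rw [← Finset.sum_mul, mul_assoc]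
    _ ≤ _ := by
        gcongr
        exact average_norm_normalizedSkewFourier_le n y

/-- Since sin x = cos(x - π/2), the phase in `averageCos` lets a single concentration estimate cover
real and imaginary parts. -/
theorem empiricalCharFun_eq_averageCos (n : ℕ) (y : ℕ → ℝ) (t : ℂ) :
    empiricalCharFun n y t = (averageCos n t 0 (fun j => y j) : ℂ)
      + (averageCos n t (-(Real.pi / 2)) (fun j => y j) : ℂ) * I := by
  simp only [empiricalCharFun, averageCos, inner_normalizedSkewFourier]
  push_cast
  rw [mul_assoc, ← mul_add, Finset.sum_mul, ← Finset.sum_add_distrib]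
  congr 1
  refine Finset.sum_congr rfl fun k _ => ?_
  rw [exp_mul_I, zero_add, neg_add_eq_sub, cos_sub_pi_div_two]

variable {Ω : Type*} [MeasurableSpace Ω]

theorem integral_empiricalCharFun {P : Measure Ω} [IsProbabilityMeasure P] {l : ℕ → Ω → ℝ}
    (hm : ∀ j, Measurable (l j)) (n : ℕ) (t : ℂ) :
    ∫ ω, empiricalCharFun n (fun j => l j ω) t ∂P = (n : ℂ)⁻¹ * ∑ k : Fin n,
      ∫ ω, exp ((inner ℝ (normalizedSkewFourier n (fun j => l j ω) k) t : ℝ) * I) ∂P := by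
  simp only [empiricalCharFun]
  rw [integral_const_mul, integral_finsetSum]
  intro k _
  refine Integrable.of_bound (C := 1) ?_
      (Eventually.of_forall fun ω => (norm_exp_ofReal_mul_I _).le)
  have := measurable_normalizedSkewFourier hm n k
  exact Measurable.aestronglyMeasurable (by fun_prop)

/-- The fluctuation around the mean vanishes almost surely by concentration, and the mean converges
by the central limit theorem, boundedness supplying the third moments. -/
theorem ae_tendsto_empiricalCharFun_of_bounded {P : Measure Ω} [IsProbabilityMeasure P]
    {l : ℕ → Ω → ℝ} (hm : ∀ j, Measurable (l j)) (hi : iIndepFun l P)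
    (hd : ∀ j, IdentDistrib (l j) (l 0) P P) {h : ℝ → ℝ} (hh : Measurable h) {B : ℝ}
    (hB : ∀ x, |h x| ≤ B) (hmean : ∫ ω, h (l 0 ω) ∂P = 0) (t : ℂ) :
    ∀ᵐ ω ∂P, Tendsto (fun n : ℕ => empiricalCharFun (n + 1) (fun j => h (l j ω)) t) atTop
      (𝓝 ((Real.exp (-((∫ ω, h (l 0 ω) ^ 2 ∂P) * ‖t‖ ^ 2 / 4)) : ℝ) : ℂ)) := by
  have hid : ∀ (g : ℝ → ℝ), Measurable g → ∀ j, ∫ ω, g (l j ω) ∂P = ∫ ω, g (l 0 ω) ∂P :=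
    fun g hg j => ((hd j).comp hg).integral_eq
  have hthird : CenteredThirdMoment (fun j ω => h (l j ω)) P (∫ ω, h (l 0 ω) ^ 2 ∂P) (B ^ 3) :=
    { measurable := fun j => hh.comp (hm j)
      indep := hi.comp (fun _ => h) fun _ => hh
      memLp := fun j => MemLp.of_bound (hh.comp (hm j)).aestronglyMeasurable B
        (Eventually.of_forall fun ω => hB _)
      mean := fun j => by rw [hid h hh j, hmean]
      second := fun j => hid (fun x => h x ^ 2) (by fun_prop) j
      third := fun j => by
        refine (le_abs_self _).trans (abs_integral_le_of_abs_le P fun ω => ?_)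
        rw [abs_pow, abs_abs]
        exact pow_le_pow_left₀ (abs_nonneg _) (hB _) 3 }
  have hE := tendsto_average_integral_exp_inner hthird t
  have hc := fun θ => ae_tendsto_averageCos_sub_integral hm hi hd hh hB t θ
  filter_upwards [hc 0, hc (-(Real.pi / 2))] with ω h1 h2
  have h3 := ((continuous_ofReal.tendsto _).comp h1).add
    (((continuous_ofReal.tendsto _).comp h2).mul_const I)
  have h4 := h3.add hE
  rw [ofReal_zero, zero_mul, add_zero, zero_add] at h4
  refine h4.congr fun n => ?_
  have hint : ∀ θ, Integrable
      (fun ω => averageCos (n + 1) t θ (fun j : Fin (n + 1) => h (l j ω))) P := fun θ =>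
    integrable_of_measurable_of_abs_le (C := 1)
      ((measurable_averageCos _ t θ).comp
        (measurable_pi_lambda _ fun j => hh.comp (hm j))) fun ω => abs_averageCos_le _ _ _ _
  rw [← integral_empiricalCharFun (l := fun j ω => h (l j ω)) fun j => hh.comp (hm j)]
  simp only [empiricalCharFun_eq_averageCos]
  rw [integral_add (hint 0).ofReal ((hint _).ofReal.mul_const _), integral_mul_const,
    integral_complex_ofReal, integral_complex_ofReal]
  simp only [Function.comp_apply]
  push_cast
  ring

end Approximation

/-! ### Truncation and centring of square-integrable variables. -/

section Truncation

/-- Truncation of the identity function at level `B`. -/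
noncomputable def truncate (B : ℕ) (x : ℝ) : ℝ := if |x| ≤ B then x else 0

theorem measurable_truncate (B : ℕ) : Measurable (truncate B) :=
  Measurable.ite (measurableSet_le (by fun_prop) measurable_const) measurable_id measurable_const

theorem abs_truncate_le (B : ℕ) (x : ℝ) : |truncate B x| ≤ B := by
  unfold truncate
  split_ifs with h
  · exact h
  · simp

theorem abs_truncate_le_abs (B : ℕ) (x : ℝ) : |truncate B x| ≤ |x| := by
  unfold truncate
  split_ifs
  · exact le_rfl
  · simp

theorem tendsto_truncate (x : ℝ) : Tendsto (fun B => truncate B x) atTop (𝓝 x) := by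
  obtain ⟨N, hN⟩ := exists_nat_ge |x|
  refine tendsto_const_nhds.congr' ?_
  filter_upwards [eventually_ge_atTop N] with B hB
  rw [truncate, if_pos (hN.trans (by exact_mod_cast hB))]

variable {Ω : Type*} [MeasurableSpace Ω]

theorem tendsto_integral_truncate {P : Measure Ω} {X : Ω → ℝ} (hX : Measurable X)
    (hXi : Integrable X P) :
    Tendsto (fun B => ∫ ω, truncate B (X ω) ∂P) atTop (𝓝 (∫ ω, X ω ∂P)) :=
  tendsto_integral_of_dominated_convergence (fun ω => |X ω|)
    (fun B => ((measurable_truncate B).comp hX).aestronglyMeasurable) hXi.abs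
    (fun B => Eventually.of_forall fun ω => abs_truncate_le_abs B (X ω))
    (Eventually.of_forall fun ω => tendsto_truncate (X ω))

/-- Truncation at level `B` followed by centring with respect to the law of `X`. -/
noncomputable def centeredTruncate (P : Measure Ω) (X : Ω → ℝ) (B : ℕ) (x : ℝ) : ℝ :=
  truncate B x - ∫ ω, truncate B (X ω) ∂P

theorem measurable_centeredTruncate (P : Measure Ω) (X : Ω → ℝ) (B : ℕ) :
    Measurable (centeredTruncate P X B) :=
  (measurable_truncate B).sub_const _

variable {P : Measure Ω} [IsProbabilityMeasure P] {X : Ω → ℝ}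

theorem abs_centeredTruncate_le (B : ℕ) (x : ℝ) : |centeredTruncate P X B x| ≤ 2 * B := by
  have h := abs_integral_le_of_abs_le P fun ω => abs_truncate_le B (X ω)
  refine (abs_sub _ _).trans ?_
  linarith [abs_truncate_le B x]

theorem integral_centeredTruncate (hX : Measurable X) (B : ℕ) :
    ∫ ω, centeredTruncate P X B (X ω) ∂P = 0 := by
  have h : Integrable (fun ω => truncate B (X ω)) P :=
    integrable_of_measurable_of_abs_le ((measurable_truncate B).comp hX)
      fun ω => abs_truncate_le B (X ω)
  simp only [centeredTruncate]
  rw [integral_sub h (integrable_const _)]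
  simp

/-- Dominated convergence for functions of quadratic growth, so that one statement gives both the
variance of the truncated variable (g = y²) and the truncation error (g = (x - y)²). -/
theorem tendsto_integral_comp_centeredTruncate (hX : Measurable X) (hX2 : MemLp X 2 P)
    (hX0 : ∫ ω, X ω ∂P = 0) {g : ℝ → ℝ → ℝ} (hg : Continuous (Function.uncurry g)) {C : ℝ}
    (hgC : ∀ x y, |g x y| ≤ C * (x ^ 2 + y ^ 2)) (hC : 0 ≤ C) :
    Tendsto (fun B => ∫ ω, g (X ω) (centeredTruncate P X B (X ω)) ∂P) atTop
      (𝓝 (∫ ω, g (X ω) (X ω) ∂P)) := by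
  have hXi : Integrable X P := hX2.integrable (by norm_num)
  set A : ℝ := ∫ ω, |X ω| ∂P with hA
  have hmean : ∀ B, |∫ ω, truncate B (X ω) ∂P| ≤ A := fun B => by
    refine abs_integral_le_integral_abs.trans ?_
    refine integral_mono_of_nonneg (Eventually.of_forall fun ω => abs_nonneg _) hXi.abs
      (Eventually.of_forall fun ω => abs_truncate_le_abs B (X ω))
  -- The centred truncation is at most |X| + A in absolute value, and X² + (|X| + A)² ≤ 3X² + 2A².
  refine tendsto_integral_of_dominated_convergence
    (fun ω => C * (3 * X ω ^ 2 + 2 * A ^ 2)) (fun B => ?_) ?_ (fun B => ?_) ?_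
  · have := (measurable_centeredTruncate P X B).comp hX
    exact (hg.measurable.comp (hX.prodMk this)).aestronglyMeasurable
  · exact ((hX2.integrable_sq.const_mul 3).add (integrable_const _)).const_mul C
  · refine Eventually.of_forall fun ω => (hgC _ _).trans ?_
    refine mul_le_mul_of_nonneg_left ?_ hC
    have h1 : |centeredTruncate P X B (X ω)| ≤ |X ω| + A :=
      (abs_sub _ _).trans (add_le_add (abs_truncate_le_abs B _) (hmean B))
    have h2 := pow_le_pow_left₀ (abs_nonneg _) h1 2
    rw [sq_abs] at h2
    nlinarith [sq_nonneg (|X ω| - A), sq_abs (X ω)]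
  · refine Eventually.of_forall fun ω => ?_
    have h1 : Tendsto (fun B => centeredTruncate P X B (X ω)) atTop (𝓝 (X ω)) := by
      have := (tendsto_truncate (X ω)).sub (tendsto_integral_truncate hX hXi)
      rwa [hX0, sub_zero] at this
    exact (hg.tendsto (X ω, X ω)).comp (tendsto_const_nhds.prodMk_nhds h1)

end Truncation

/-! ### Almost sure convergence of the spectral distribution. -/

section AlmostSure

variable {Ω : Type*} [MeasurableSpace Ω] {P : Measure Ω} {l : ℕ → Ω → ℝ}

theorem IIDStandard.ae_tendsto_average (hl : IIDStandard l P) {g : ℝ → ℝ} (hg : Measurable g)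
    (hint : Integrable (fun ω => g (l 0 ω)) P) :
    ∀ᵐ ω ∂P, Tendsto (fun n : ℕ => (∑ j ∈ Finset.range n, g (l j ω)) / n) atTop
      (𝓝 (∫ ω, g (l 0 ω) ∂P)) :=
  strong_law_ae_real (fun j ω => g (l j ω)) hint
    (fun _ _ hij => (hl.indep.indepFun hij).comp hg hg) fun j => (hl.identDistrib j).comp hg

theorem IIDStandard.integral_sq (hl : IIDStandard l P) : ∫ ω, l 0 ω ^ 2 ∂P = 1 := by
  have h := hl.variance
  rwa [variance_of_integral_eq_zero (hl.measurable 0).aemeasurable hl.mean] at h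

variable [IsProbabilityMeasure P]

/-- Truncation levels are natural numbers, so one null set serves them all. The error of level B is
asymptotically at most ‖t‖ times the L² norm of the discarded part, which tends to 0 as B grows. -/
theorem IIDStandard.ae_tendsto_empiricalCharFun (hl : IIDStandard l P) (t : ℂ) :
    ∀ᵐ ω ∂P, Tendsto (fun n : ℕ => empiricalCharFun (n + 1) (fun j => l j ω) t) atTop
      (𝓝 ((Real.exp (-(‖t‖ ^ 2 / 4)) : ℝ) : ℂ)) := by
  set h : ℕ → ℝ → ℝ := centeredTruncate P (l 0) with hh
  have hhm : ∀ B, Measurable (h B) := measurable_centeredTruncate P (l 0)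
  have hlim1 := tendsto_integral_comp_centeredTruncate (hl.measurable 0) hl.memLp hl.mean
    (g := fun _ y => y ^ 2) (by fun_prop) (C := 1) (fun x y => by
      rw [abs_of_nonneg (sq_nonneg y)]; nlinarith [sq_nonneg x]) zero_le_one
  have hlim2 := tendsto_integral_comp_centeredTruncate (hl.measurable 0) hl.memLp hl.mean
    (g := fun x y => (x - y) ^ 2) (by fun_prop) (C := 2) (fun x y => by
      rw [abs_of_nonneg (sq_nonneg _)]; nlinarith [sq_nonneg (x + y)]) zero_le_two
  simp only [hl.integral_sq, sub_self, ne_eq, OfNat.ofNat_ne_zero, not_false_eq_true, zero_pow,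
    integral_zero] at hlim1 hlim2
  have hae1 : ∀ᵐ ω ∂P, ∀ B, Tendsto
      (fun n : ℕ => empiricalCharFun (n + 1) (fun j => h B (l j ω)) t) atTop
      (𝓝 ((Real.exp (-((∫ ω, h B (l 0 ω) ^ 2 ∂P) * ‖t‖ ^ 2 / 4)) : ℝ) : ℂ)) :=
    ae_all_iff.2 fun B => ae_tendsto_empiricalCharFun_of_bounded hl.measurable hl.indep
      hl.identDistrib (hhm B) (abs_centeredTruncate_le B) (integral_centeredTruncate
        (hl.measurable 0) B) t
  have hae2 : ∀ᵐ ω ∂P, ∀ B, Tendsto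
      (fun n : ℕ => (∑ j ∈ Finset.range n, (l j ω - h B (l j ω)) ^ 2) / n) atTop
      (𝓝 (∫ ω, (l 0 ω - h B (l 0 ω)) ^ 2 ∂P)) :=
    ae_all_iff.2 fun B => hl.ae_tendsto_average (g := fun x => (x - h B x) ^ 2)
      ((measurable_id.sub (hhm B)).pow_const 2) (by
        have : MemLp (fun ω => l 0 ω - h B (l 0 ω)) 2 P :=
          hl.memLp.sub (MemLp.of_bound ((hhm B).comp (hl.measurable 0)).aestronglyMeasurable (2 * B)
            (Eventually.of_forall fun ω => abs_centeredTruncate_le B _))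
        exact this.integrable_sq)
  filter_upwards [hae1, hae2] with ω h1 h2
  refine tendsto_of_forall_approx fun ε hε => ?_
  have hl1 : Tendsto (fun B => ((Real.exp (-((∫ ω, h B (l 0 ω) ^ 2 ∂P) * ‖t‖ ^ 2 / 4)) : ℝ) : ℂ))
      atTop (𝓝 ((Real.exp (-(‖t‖ ^ 2 / 4)) : ℝ) : ℂ)) := by
    refine (Complex.continuous_ofReal.tendsto _).comp ((Real.continuous_exp.tendsto _).comp ?_)
    have := ((hlim1.mul_const (‖t‖ ^ 2)).div_const 4).neg
    rwa [one_mul] at this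
  have hl2 : Tendsto (fun B => Real.sqrt (∫ ω, (l 0 ω - h B (l 0 ω)) ^ 2 ∂P) * ‖t‖)
      atTop (𝓝 0) := by
    have := hlim2.sqrt.mul_const ‖t‖
    rwa [Real.sqrt_zero, zero_mul] at this
  obtain ⟨B, hB1, hB2⟩ := ((Metric.tendsto_nhds.1 hl1 ε hε).and
    (hl2.eventually (gt_mem_nhds hε))).exists
  refine ⟨_, _, h1 B, ?_, ?_⟩
  · rw [dist_eq_norm] at hB1
    exact hB1.le
  · have h3 := ((h2 B).sqrt.mul_const ‖t‖).eventually (gt_mem_nhds hB2)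
    filter_upwards [(tendsto_add_atTop_nat 1).eventually h3] with n hn
    exact (norm_empiricalCharFun_sub_le (n + 1) _ _ t).trans hn.le

/-- The null set must not depend on `t`. A countable dense set suffices because, by the strong law
for squares, the functions are eventually Lipschitz in `t` with constant 2. -/
theorem IIDStandard.ae_forall_tendsto_empiricalCharFun (hl : IIDStandard l P) :
    ∀ᵐ ω ∂P, ∀ t : ℂ, Tendsto (fun n : ℕ => empiricalCharFun (n + 1) (fun j => l j ω) t) atTop
      (𝓝 ((Real.exp (-(‖t‖ ^ 2 / 4)) : ℝ) : ℂ)) := by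
  have hae1 : ∀ᵐ ω ∂P, ∀ i : ℕ, Tendsto
      (fun n : ℕ => empiricalCharFun (n + 1) (fun j => l j ω) (TopologicalSpace.denseSeq ℂ i)) atTop
      (𝓝 ((Real.exp (-(‖TopologicalSpace.denseSeq ℂ i‖ ^ 2 / 4)) : ℝ) : ℂ)) :=
    ae_all_iff.2 fun i => hl.ae_tendsto_empiricalCharFun _
  have hae2 := hl.ae_tendsto_average (g := fun x => x ^ 2) (by fun_prop) hl.memLp.integrable_sq
  rw [hl.integral_sq] at hae2
  filter_upwards [hae1, hae2] with ω h1 h2 t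
  refine tendsto_of_forall_approx fun ε hε => ?_
  have hcont : Continuous fun s : ℂ => ((Real.exp (-(‖s‖ ^ 2 / 4)) : ℝ) : ℂ) := by fun_prop
  obtain ⟨δ, hδ, hδt⟩ := Metric.continuous_iff.1 hcont t ε hε
  obtain ⟨i, hi⟩ := (TopologicalSpace.denseRange_denseSeq ℂ).exists_dist_lt t
    (lt_min hδ (half_pos hε))
  refine ⟨_, _, h1 i, ?_, ?_⟩
  · have := hδt (TopologicalSpace.denseSeq ℂ i) (by
      rw [dist_comm]; exact hi.trans_le (min_le_left _ _))
    rw [dist_eq_norm] at this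
    exact this.le
  · have h3 : ∀ᶠ n : ℕ in atTop, Real.sqrt ((∑ j ∈ Finset.range n, l j ω ^ 2) / n) < 2 := by
      refine h2.sqrt.eventually (gt_mem_nhds ?_)
      rw [Real.sqrt_one]
      exact one_lt_two
    filter_upwards [(tendsto_add_atTop_nat 1).eventually h3] with n hn
    refine (norm_empiricalCharFun_sub_le' (n + 1) _ _ _).trans ?_
    have h4 : ‖t - TopologicalSpace.denseSeq ℂ i‖ ≤ ε / 2 := by
      rw [← dist_eq_norm]
      exact hi.le.trans (min_le_right _ _)
    calc _ ≤ 2 * (ε / 2) := mul_le_mul hn.le h4 (norm_nonneg _) zero_le_two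
      _ = ε := by ring

/-- The empirical measure of the normalized Fourier transform of a real sequence. -/
noncomputable def empiricalSkewFourierLaw (y : ℕ → ℝ) (n : ℕ) : ProbabilityMeasure ℂ :=
  averageSkewFourierLaw (P := Measure.dirac ()) (l := fun j _ => y j) (fun _ => measurable_const) n

theorem charFun_empiricalSkewFourierLaw (y : ℕ → ℝ) (n : ℕ) (t : ℂ) :
    charFun (empiricalSkewFourierLaw y n : Measure ℂ) t = empiricalCharFun (n + 1) y t := by
  refine (charFun_averageLaw (Measure.dirac ()) (fun k => measurable_const) t).trans ?_
  simp [empiricalCharFun]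

theorem integral_empiricalSkewFourierLaw (y : ℕ → ℝ) (n : ℕ) {f : ℂ → ℝ} (hf : Continuous f) :
    ∫ z, f z ∂(empiricalSkewFourierLaw y n : Measure ℂ)
      = ((n + 1 : ℕ) : ℝ)⁻¹ * ∑ k, f (normalizedSkewFourier (n + 1) y k) := by
  refine (integral_averageLaw (Measure.dirac ()) (fun k => measurable_const) hf
    fun k => integrable_const _).trans ?_
  simp

theorem integral_empiricalSpectralDistribution {n : ℕ} [NeZero n] (A : Matrix (Fin n) (Fin n) ℝ)
    (hA : A.IsHermitian) (f : ℝ → ℝ) :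
    ∫ x, f x ∂(empiricalSpectralDistribution A hA : Measure ℝ)
      = (n : ℝ)⁻¹ * ∑ j, f (hA.eigenvalues j) := by
  change ∫ x, f x ∂((n : ENNReal)⁻¹ • ∑ j, Measure.dirac (hA.eigenvalues j)) = _
  rw [integral_smul_measure, integral_finsetSum_measure]
  · simp
  · intro j _
    exact integrable_dirac (by simp)

theorem abs_integral_empiricalSpectralDistribution_sub_le (n : ℕ) (y : ℕ → ℝ) {f : ℝ → ℝ}
    (hf : Continuous f) {C : ℝ} (hC : ∀ x, |f x| ≤ C) :
    |∫ x, f x ∂(empiricalSpectralDistribution (normalizedLeftSkewCirculant (n + 1) y)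
        (normalizedLeftSkewCirculant_isHermitian (n + 1) y) : Measure ℝ)
      - ∫ z, (f ‖z‖ + f (-‖z‖)) / 2 ∂(empiricalSkewFourierLaw y n : Measure ℂ)|
      ≤ ((n + 1 : ℕ) : ℝ)⁻¹ * (2 * C) := by
  rw [integral_empiricalSpectralDistribution,
    integral_empiricalSkewFourierLaw y n (f := fun z => (f ‖z‖ + f (-‖z‖)) / 2) (by fun_prop),
    ← mul_sub, abs_mul, abs_of_nonneg (by positivity)]
  gcongr
  -- The eigenvalues depend on the proof of symmetry, so the matrix and that proof are generalized
  -- together before the scaling is moved into the input sequence.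
  have h : ∀ (A : Matrix (Fin (n + 1)) (Fin (n + 1)) ℝ) (hA : A.IsHermitian),
      A = leftSkewCirculant (n + 1) ((Real.sqrt (n + 1 : ℕ))⁻¹ • y) →
      |∑ j, f (hA.eigenvalues j) - ∑ k, (f ‖normalizedSkewFourier (n + 1) y k‖
        + f (-‖normalizedSkewFourier (n + 1) y k‖)) / 2| ≤ 2 * C := by
    rintro A hA rfl
    exact abs_sum_comp_eigenvalues_sub_le (n + 1) _ hA f C hC
  exact h _ _ (normalizedLeftSkewCirculant_eq (n + 1) y)

/-- For a fixed good ω, Lévy's theorem gives weak convergence of the empirical law of the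
coefficients. Testing it on z ↦ (f(‖z‖) + f(-‖z‖))/2 gives the spectral integral of f up to O(1/n),
with the Rayleigh integral as limit. -/
theorem IIDStandard.ae_tendsto_empiricalSpectralDistribution (hl : IIDStandard l P) :
    ∀ᵐ ω ∂P, Tendsto
      (fun n : ℕ => empiricalSpectralDistribution
        (normalizedLeftSkewCirculant (n + 1) (fun k => l k ω))
        (normalizedLeftSkewCirculant_isHermitian (n + 1) (fun k => l k ω)))
      atTop (𝓝 symmetrizedRayleigh) := by
  filter_upwards [hl.ae_forall_tendsto_empiricalCharFun] with ω hω
  set y : ℕ → ℝ := fun k => l k ω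
  have hconv : Tendsto (empiricalSkewFourierLaw y) atTop (𝓝 complexGaussian) := by
    refine ProbabilityMeasure.tendsto_of_tendsto_charFun fun t => ?_
    simp only [charFun_empiricalSkewFourierLaw, charFun_complexGaussian]
    convert hω t using 2
    push_cast
    ring_nf
  rw [ProbabilityMeasure.tendsto_iff_forall_integral_tendsto]
  intro f
  have hC : ∀ x, |f x| ≤ ‖f‖ := fun x => f.norm_coe_le_norm x
  have hcont : Continuous fun z : ℂ => (f ‖z‖ + f (-‖z‖)) / 2 := by fun_prop
  have h1 := (ProbabilityMeasure.tendsto_iff_forall_integral_tendsto.1 hconv)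
    (BoundedContinuousFunction.ofNormedAddCommGroup (fun z : ℂ => (f ‖z‖ + f (-‖z‖)) / 2) hcont ‖f‖
      fun z => by
        have h2 := abs_le.1 (hC ‖z‖)
        have h3 := abs_le.1 (hC (-‖z‖))
        rw [Real.norm_eq_abs, abs_le]
        constructor <;> linarith)
  simp only [BoundedContinuousFunction.coe_ofNormedAddCommGroup] at h1
  rw [← integral_symmetrizedRayleigh_eq_complexGaussian f (f.integrable _)] at h1
  have h4 : Tendsto (fun n : ℕ => ((n + 1 : ℕ) : ℝ)⁻¹ * (2 * ‖f‖)) atTop (𝓝 0) := by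
    have h1 : Tendsto (fun n : ℕ => (n : ℝ)⁻¹) atTop (𝓝 0) :=
      tendsto_inv_atTop_zero.comp tendsto_natCast_atTop_atTop
    simpa using ((tendsto_add_atTop_iff_nat 1).2 h1).mul_const (2 * ‖f‖)
  have h5 : Tendsto (fun n : ℕ => ∫ x, f x ∂(empiricalSpectralDistribution
        (normalizedLeftSkewCirculant (n + 1) y)
        (normalizedLeftSkewCirculant_isHermitian (n + 1) y) : Measure ℝ)
      - ∫ z, (f ‖z‖ + f (-‖z‖)) / 2 ∂(empiricalSkewFourierLaw y n : Measure ℂ)) atTop (𝓝 0) :=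
    squeeze_zero_norm
      (fun n => abs_integral_empiricalSpectralDistribution_sub_le n y f.continuous hC) h4
  have h6 := h5.add h1
  rw [zero_add] at h6
  refine h6.congr fun n => ?_
  ring

end AlmostSure

theorem theorem3p3 {Ω : Type*} [MeasurableSpace Ω] (P : Measure Ω) [IsProbabilityMeasure P]
    (l : ℕ → Ω → ℝ) :
    (∀ hl : IndepStandardBddMoments l P,
      ∃ (A : Type) (_ : Ring A) (_ : StarRing A) (_ : Algebra ℂ A) (_ : StarModule ℂ A)
        (φ : NCState A) (a : A),
        IsSelfAdjoint a ∧
        (∀ m : ℕ, 1 ≤ m → φ.toLin (a ^ (2 * m - 1)) = 0) ∧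
        (∀ m : ℕ, 1 ≤ m → φ.toLin (a ^ (2 * m)) = (m.factorial : ℂ)) ∧
        ConvergesInStarDistribution (fun n => randomMatrixState P (n + 1))
          (fun n => leftSkewCirculantVariable hl (n + 1)) φ a) ∧
    (IIDStandard l P →
      ∀ᵐ ω ∂P, Tendsto
        (fun n : ℕ => empiricalSpectralDistribution
          (normalizedLeftSkewCirculant (n + 1) (fun k => l k ω))
          (normalizedLeftSkewCirculant_isHermitian (n + 1) (fun k => l k ω)))
        atTop (𝓝 symmetrizedRayleigh)) := by
  refine ⟨fun hl => ⟨randomMatrixAlgebra (symmetrizedRayleigh : Measure ℝ) 1, inferInstance,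
    inferInstance, inferInstance, inferInstance,
    randomMatrixState (symmetrizedRayleigh : Measure ℝ) 1, rayleighVariable,
    isSelfAdjoint_rayleighVariable, fun m hm => ?_, fun m _ => ?_,
    convergesInStarDistribution_leftSkewCirculant hl⟩,
    fun hl => hl.ae_tendsto_empiricalSpectralDistribution⟩
  · obtain ⟨m, rfl⟩ : ∃ k, m = k + 1 := ⟨m - 1, by omega⟩
    rw [show 2 * (m + 1) - 1 = 2 * m + 1 by omega, randomMatrixState_rayleighVariable_pow,
      integral_pow_odd_symmetrizedRayleigh, Complex.ofReal_zero]
  · rw [randomMatrixState_rayleighVariable_pow, integral_pow_even_symmetrizedRayleigh]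
    simp
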